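/- **Setting.** All manifolds and maps are smooth and finite dimensional. A Lie group $G$ with Lie algebra $\mathfrak g$ acts smoothly and freely on a manifold $Q$ so that $\pi:Q\to Q/G$ is a principal bundle; $g q$ denotes the action, $\xi_Q$ the infinitesimal generator of $\xi\in\mathfrak g$, and $\mathcal V_q=\{\xi_Q(q):\xi\in\mathfrak g\}$ the vertical space. For $\xi\in\mathfrak g$, $w\in G$, $\xi w\in T_wG$ is the right translate. A *discrete mechanical system* $(Q,L_d,\mathcal D,\mathcal D_d)$ consists of a function $L_d:Q\times Q\to\mathbb R$, a subbundle $\mathcal D\subset TQ$ and a submanifold $\mathcal D_d\subset Q\times Q$. Assume that $G$ is a *symmetry group*: $L_d$ and $\mathcal D_d$ are invariant under the diagonal action, $\mathcal D$ under the lifted action. Assume that $\mathcal S:=\mathcal V\cap\mathcal D$ is a subbundle, and fix $G$-invariant subbundles $\mathcal H,\mathcal U,\mathcal W$ of $TQ$ with $\mathcal D=\mathcal S\oplus\mathcal H$, $\mathcal V=\mathcal S\oplus\mathcal U$, $TQ=(\mathcal D+\mathcal V)\oplus\mathcal W$. Then $\mathcal W\oplus\mathcal H$ is the horizontal bundle of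 a connection on $\pi$; its horizontal lift is $h^q:T_{\pi(q)}(Q/G)\to T_qQ$. Put $\hat{\mathcal D}_{\pi(q)}:=d\pi(q)(\mathcal D_q)$ and $\mathfrak g^{\mathcal D}:=\{(q,\xi):\xi_Q(q)\in\mathcal D_q\}\subset Q\times\mathfrak g$. Fix an *affine discrete connection* of level $\gamma$: a smooth $\gamma:Q\to G$ with $\gamma(gq)=g\gamma(q)g^{-1}$ and a $G$-invariant submanifold $Hor\subset Q\times Q$ containing all $(q,\gamma(q)q)$ such that, for each $q$, $Hor^2(q):=\{q_1:(q,q_1)\in Hor\}$ is a submanifold of $Q$ and $T_{q_1}Q=T_{q_1}(Gq)\oplus T_{q_1}Hor^2(q)$ for all $q_1\in Gq\cap Hor^2(q)$. Fix also a $G$-invariant open neighbourhood $U$ of the level $\{(q,\gamma(q)q)\}$. The *discrete connection form* $\mathcal A_d(q_0,q_1)\in G$ is the unique $g$ with $(q_0,g^{-1}q_1)\in Hor\cap U$. Let $W\subset Q/G\times Q/G$ be the largest open set such that $\mathcal A_d$ is defined (existence and uniqueness) and smooth for $(\pi(q_0),\pi(q_1))\in W$; everything involving $\mathcal A_d$ is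 considered over $W$. For $(\pi(q_0),r_1)\in W$ let $\overline h_d^{q_0}(r_1)$ be the unique $q_1\in\pi^{-1}(r_1)$ with $(q_0,q_1)\in Hor\cap U$. Let $\tilde G:=(Q\times G)/G$ for the action $g(q,w)=(gq,gwg^{-1})$, with quotient map $\rho:Q\times G\to\tilde G$. Define $$\tilde F_1(q_0,w_0,r_1):=w_0\,\overline h_d^{q_0}(r_1),\qquad \check L_d(q_0,w_0,r_1):=L_d(q_0,\tilde F_1(q_0,w_0,r_1)),\qquad \hat L_d(\rho(q_0,w_0),r_1):=\check L_d(q_0,w_0,r_1),$$ $$\hat{\mathcal D}_d:=\{(\rho(q_0,\mathcal A_d(q_0,q_1)),\pi(q_1)):(q_0,q_1)\in\mathcal D_d\}\subset\tilde G\times Q/G,$$ and, with $v_0=\rho(q_0,w_0)$ and $q_1=\tilde F_1(q_0,w_0,r_1)$, the reduced forces $$\hat F_d^-(v_0,r_1):=D_2\check L_d(q_0,w_0,r_1)\circ D_1\mathcal A_d(q_0,q_1)\circ h^{q_0}\in T^*_{\pi(q_0)}(Q/G),\qquad \hat F_d^+(v_0,r_1):=D_2\check L_d(q_0,w_0,r_1)\circ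 D_2\mathcal A_d(q_0,q_1)\circ h^{q_1}\in T^*_{r_1}(Q/G).$$ Let $Q^{(2)}_G:=(\tilde G\times Q/G)\times_{Q/G}(\tilde G\times Q/G)$ be the second order reduced manifold of points $(v_0,r_1,v_1,r_2)$ for which $v_1$ lies over $r_1$, with $p_2(v_0,r_1,v_1,r_2)=r_1$, and $\check Q^{(2)}_G:=(Q\times G\times Q/G)\times_{Q/G}(\tilde G\times Q/G)$ the space of points $(q_0,w_0,r_1,v_1,r_2)$ for which $v_1$ lies over $r_1$. $G$ acts on the latter by $g(q_0,w_0,r_1,v_1,r_2)=(gq_0,gw_0g^{-1},r_1,v_1,r_2)$, with quotient $Q^{(2)}_G$. On $\check Q^{(2)}_G$ let $F_1:=q_1:=\tilde F_1(q_0,w_0,r_1)\in Q$ and let $F_2:=w_1\in G$ be determined by $v_1=\rho(q_1,w_1)$. For $\delta r_1\in T_{r_1}(Q/G)$ and $\xi_1\in\mathfrak g$ put $$\check\phi(q_0,w_0,r_1,v_1,r_2,\delta r_1):=\bigl(D_1\check L_d(q_1,w_1,r_2)\circ h^{q_1}+D_3\check L_d(q_0,w_0,r_1)+\hat F_d^-(v_1,r_2)+\hat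 F_d^+(\rho(q_0,w_0),r_1)\bigr)(\delta r_1),$$ $$\check\psi(q_0,w_0,r_1,v_1,r_2,\xi_1):=D_2\check L_d(q_0,w_0,r_1)(\xi_1w_0)-D_2\check L_d(q_1,w_1,r_2)(\xi_1w_1).$$ Both are $G$-invariant ($G$ acting on $\mathfrak g$ by the adjoint action) and fibrewise linear, and induce $\bar\phi:p_2^*T(Q/G)\to\mathbb R$ and $\bar\psi:(\check Q^{(2)}_G\times\mathfrak g)/G\to\mathbb R$ over $Q^{(2)}_G$. **Statement.** Let $q_\cdot=(q_0,\dots,q_N)$ be a discrete curve in $Q$ with $(\pi(q_k),\pi(q_{k+1}))\in W$ for $0\le k<N$, and let $r_k:=\pi(q_k)$, $w_k:=\mathcal A_d(q_k,q_{k+1})$, $v_k:=\rho(q_k,w_k)$. The following five conditions are equivalent. 1. $(q_k,q_{k+1})\in\mathcal D_d$ for $0\le k<N$, and $\sum_{k=0}^{N-1}dL_d(q_k,q_{k+1})(\delta q_k,\delta q_{k+1})=0$ for all $\delta q_k\in\mathcal D_{q_k}$ ($0\le k\le N$) with $\delta q_0=0$, $\delta q_N=0$. 2. $(q_k,q_{k+1})\in\mathcal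 D_d$ for $0\le k<N$, and $D_1L_d(q_k,q_{k+1})+D_2L_d(q_{k-1},q_k)$ vanishes on $\mathcal D_{q_k}$ for $1\le k\le N-1$. 3. $(v_k,r_{k+1})\in\hat{\mathcal D}_d$ for $0\le k<N$, and $\sum_{k=0}^{N-1}d\hat L_d(v_k,r_{k+1})(\delta v_k,\delta r_{k+1})=0$ for all variations such that $\delta r_k\in\hat{\mathcal D}_{r_k}$ and $(q_k,\xi_k)\in\mathfrak g^{\mathcal D}$ ($0\le k\le N$) with $\delta r_0=0$, $\delta r_N=0$, $\xi_0=0$, $\xi_N=0$, and $$\delta v_k=d\rho(q_k,w_k)\bigl(h^{q_k}(\delta r_k),\,d\mathcal A_d(q_k,q_{k+1})(h^{q_k}(\delta r_k),h^{q_{k+1}}(\delta r_{k+1}))\bigr)+d\rho(q_k,w_k)\bigl((\xi_k)_Q(q_k),\,d\mathcal A_d(q_k,q_{k+1})((\xi_k)_Q(q_k),(\xi_{k+1})_Q(q_{k+1}))\bigr)$$ for $0\le k<N$. 4. $(v_k,r_{k+1})\in\hat{\mathcal D}_d$ for $0\le k<N$, and for $1\le k\le N-1$ the form $D_1\check L_d(q_k,w_k,r_{k+1})\circ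 h^{q_k}+D_3\check L_d(q_{k-1},w_{k-1},r_k)+\hat F_d^-(v_k,r_{k+1})+\hat F_d^+(v_{k-1},r_k)$ vanishes on $\hat{\mathcal D}_{r_k}$ and the form $\xi\mapsto D_2\check L_d(q_{k-1},w_{k-1},r_k)(\xi w_{k-1})-D_2\check L_d(q_k,w_k,r_{k+1})(\xi w_k)$ vanishes on $\mathfrak g^{\mathcal D}_{q_k}$. 5. $(v_k,r_{k+1})\in\hat{\mathcal D}_d$ for $0\le k<N$, and for $1\le k\le N-1$, over the point $(v_{k-1},r_k,v_k,r_{k+1})$ of $Q^{(2)}_G$, $\bar\phi$ vanishes on the fibre of $p_2^*\hat{\mathcal D}$ and $\bar\psi$ vanishes on the fibre of $(F_1^*\mathfrak g^{\mathcal D})/G$. -/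

import Mathlib

open Set
open scoped Manifold ContDiff Topology

noncomputable section

namespace DiscreteReduction

/-! ### Submanifolds and subbundles -/

section General

variable {E H M : Type*} [NormedAddCommGroup E] [NormedSpace ℝ E] [TopologicalSpace H]
  (I : ModelWithCorners ℝ E H) [TopologicalSpace M] [ChartedSpace H M]

/-- `S` is an embedded smooth submanifold of `M`: around each of its points there is a smooth chart
of `M` in which `S` is an affine slice. -/
def IsSubmanifold (S : Set M) : Prop :=
  ∀ x ∈ S, ∃ e ∈ IsManifold.maximalAtlas I ∞ M, x ∈ e.source ∧
    ∃ F : Submodule ℝ E, ∀ y ∈ e.source, (y ∈ S ↔ e.extend I y - e.extend I x ∈ F)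

/-- The tangent space at `x` of a submanifold `S`, as a subspace of the tangent space of `M`:
the velocities of smooth curves in `S` through `x` (for a submanifold they already form a
subspace). -/
def tangentOf (S : Set M) (x : M) : Submodule ℝ (TangentSpace I x) :=
  Submodule.span ℝ {v | ∃ c : ℝ → M, ContMDiffAt 𝓘(ℝ, ℝ) I ∞ c 0 ∧ c 0 = x ∧
    (∀ᶠ t in 𝓝 (0 : ℝ), c t ∈ S) ∧ v = (mfderiv 𝓘(ℝ, ℝ) I c 0 (1 : ℝ) : E)}

/-- `D` is a smooth vector subbundle of the tangent bundle of `M`: it has smooth local frames. -/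
def IsSubbundle [IsManifold I 1 M] (D : ∀ x : M, Submodule ℝ (TangentSpace I x)) : Prop :=
  ∀ x₀ : M, ∃ u : Set M, IsOpen u ∧ x₀ ∈ u ∧ ∃ (m : ℕ) (X : Fin m → ∀ x : M, TangentSpace I x),
    (∀ i, ContMDiffOn I I.tangent ∞ (fun x => (⟨x, X i x⟩ : TangentBundle I M)) u) ∧
    ∀ x ∈ u, LinearIndependent ℝ (fun i => X i x) ∧
      Submodule.span ℝ (range fun i => X i x) = D x

end General

section Calculus

variable {E₁ H₁ M₁ E₂ H₂ M₂ E₃ H₃ M₃ : Type*}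
  [NormedAddCommGroup E₁] [NormedSpace ℝ E₁] [TopologicalSpace H₁]
  {I₁ : ModelWithCorners ℝ E₁ H₁} [TopologicalSpace M₁] [ChartedSpace H₁ M₁]
  [NormedAddCommGroup E₂] [NormedSpace ℝ E₂] [TopologicalSpace H₂]
  {I₂ : ModelWithCorners ℝ E₂ H₂} [TopologicalSpace M₂] [ChartedSpace H₂ M₂]
  [NormedAddCommGroup E₃] [NormedSpace ℝ E₃] [TopologicalSpace H₃]
  {I₃ : ModelWithCorners ℝ E₃ H₃} [TopologicalSpace M₃] [ChartedSpace H₃ M₃]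

/-- The chain rule for precomposition with a diffeomorphism needs no hypothesis on `f`. -/
theorem mfderiv_comp_right {f : M₂ → M₃} {φ : M₁ → M₂} {ψ : M₂ → M₁}
    (hφ : MDifferentiable I₁ I₂ φ) (hψ : MDifferentiable I₂ I₁ ψ)
    (h₁ : ∀ x, ψ (φ x) = x) (h₂ : ∀ y, φ (ψ y) = y) (x : M₁) :
    mfderiv I₁ I₃ (fun x => f (φ x)) x = (mfderiv I₂ I₃ f (φ x)).comp (mfderiv I₁ I₂ φ x) := by
  by_cases hf : MDifferentiableAt I₂ I₃ f (φ x)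
  · exact mfderiv_comp x hf (hφ x)
  · have hc : ¬ MDifferentiableAt I₁ I₃ (fun x => f (φ x)) x := by
      intro hc
      apply hf
      have hc' : MDifferentiableAt I₁ I₃ (fun x => f (φ x)) (ψ (φ x)) := by rwa [h₁]
      have := hc'.comp (φ x) (hψ (φ x))
      refine this.congr_of_eventuallyEq (Filter.Eventually.of_forall fun y => ?_)
      simp [h₂]
    rw [mfderiv_zero_of_not_mdifferentiableAt hf, mfderiv_zero_of_not_mdifferentiableAt hc]
    rfl

/-- The chain rule for postcomposition with a diffeomorphism needs no hypothesis on `f`. -/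
theorem mfderiv_comp_left {f : M₁ → M₂} {φ : M₂ → M₃} {ψ : M₃ → M₂}
    (hφ : MDifferentiable I₂ I₃ φ) (hψ : MDifferentiable I₃ I₂ ψ)
    (h₁ : ∀ x, ψ (φ x) = x) (x : M₁) :
    mfderiv I₁ I₃ (fun x => φ (f x)) x = (mfderiv I₂ I₃ φ (f x)).comp (mfderiv I₁ I₂ f x) := by
  by_cases hf : MDifferentiableAt I₁ I₂ f x
  · exact mfderiv_comp x (hφ _) hf
  · have hc : ¬ MDifferentiableAt I₁ I₃ (fun x => φ (f x)) x := by
      intro hc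
      apply hf
      have := (hψ (φ (f x))).comp x hc
      refine this.congr_of_eventuallyEq (Filter.Eventually.of_forall fun y => ?_)
      simp [h₁]
    rw [mfderiv_zero_of_not_mdifferentiableAt hf, mfderiv_zero_of_not_mdifferentiableAt hc]
    ext v
    simp

end Calculus

/-! ### The principal bundle `Q → Q/G` -/

/-- The quotient `Q/G`. -/
abbrev Base (G Q : Type*) [Group G] [MulAction G Q] : Type _ := MulAction.orbitRel.Quotient G Q

/-- The quotient map `π : Q → Q/G`. -/
def proj (G : Type*) {Q : Type*} [Group G] [MulAction G Q] (q : Q) : Base G Q :=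
  Quotient.mk (MulAction.orbitRel G Q) q

theorem proj_smul {G Q : Type*} [Group G] [MulAction G Q] (g : G) (q : Q) :
    proj G (g • q) = proj G q :=
  MulAction.orbitRel.Quotient.quotient_smul_eq

theorem proj_eq_iff {G Q : Type*} [Group G] [MulAction G Q] {q q' : Q} :
    proj G q = proj G q' ↔ ∃ g : G, g • q' = q := by
  unfold proj
  rw [Quotient.eq, MulAction.orbitRel_apply, MulAction.mem_orbit_iff]

section Bundle

variable (EQ EG EB G Q : Type*)
  [NormedAddCommGroup EQ] [NormedSpace ℝ EQ] [NormedAddCommGroup EG] [NormedSpace ℝ EG]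
  [NormedAddCommGroup EB] [NormedSpace ℝ EB]
  [TopologicalSpace G] [ChartedSpace EG G] [Group G]
  [TopologicalSpace Q] [ChartedSpace EQ Q] [MulAction G Q] [ChartedSpace EB (Base G Q)]

/-- The Lie group `G` acts smoothly and freely on `Q` and, for the given smooth structure on `Q/G`,
the quotient map `π : Q → Q/G` is a smooth principal bundle with structure group `G`: over a
neighbourhood `U` of each point there is a local trivialisation `q ↦ (π q, θ q)`,
from `π⁻¹(U)` to `U × G`, with smooth inverse `(r, g) ↦ g • s r`. -/
structure PrincipalBundle : Prop where
  smooth_smul : ContMDiff (𝓘(ℝ, EG).prod 𝓘(ℝ, EQ)) 𝓘(ℝ, EQ) ∞ fun x : G × Q => x.1 • x.2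
  free : ∀ (g : G) (q : Q), g • q = q → g = 1
  smooth_proj : ContMDiff 𝓘(ℝ, EQ) 𝓘(ℝ, EB) ∞ (proj G : Q → Base G Q)
  locally_trivial : ∀ r₀ : Base G Q, ∃ (U : Set (Base G Q)) (s : Base G Q → Q) (θ : Q → G),
    IsOpen U ∧ r₀ ∈ U ∧ ContMDiffOn 𝓘(ℝ, EB) 𝓘(ℝ, EQ) ∞ s U ∧ (∀ r ∈ U, proj G (s r) = r) ∧
    ContMDiffOn 𝓘(ℝ, EQ) 𝓘(ℝ, EG) ∞ θ (proj G ⁻¹' U) ∧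
    ∀ q, proj G q ∈ U → θ q • s (proj G q) = q

/-- The equivalence relation on `Q × G` whose classes are the orbits of the action
`g · (q, w) = (g q, g w g⁻¹)`. -/
def conjSetoid (G Q : Type*) [Group G] [MulAction G Q] : Setoid (Q × G) where
  r a b := ∃ g : G, (g • b.1, g * b.2 * g⁻¹) = a
  iseqv :=
    { refl := fun a => ⟨1, by simp⟩
      symm := by
        rintro a b ⟨g, rfl⟩
        exact ⟨g⁻¹, by simp [mul_assoc]⟩
      trans := by
        rintro a b c ⟨g, rfl⟩ ⟨h, rfl⟩
        exact ⟨g * h, by simp [mul_assoc, mul_smul]⟩ }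

end Bundle

section ConjBundle

variable {EQ EG EB G Q : Type*}
  [NormedAddCommGroup EQ] [NormedSpace ℝ EQ] [NormedAddCommGroup EG] [NormedSpace ℝ EG]
  [NormedAddCommGroup EB] [NormedSpace ℝ EB]
  [TopologicalSpace G] [ChartedSpace EG G] [Group G]
  [TopologicalSpace Q] [ChartedSpace EQ Q] [MulAction G Q] [ChartedSpace EB (Base G Q)]

/-- The conjugate associated bundle `G̃ = (Q × G)/G`. -/
def TildeG (_P : PrincipalBundle EQ EG EB G Q) : Type _ := Quotient (conjSetoid G Q)

namespace TildeG

variable (P : PrincipalBundle EQ EG EB G Q)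

/-- The quotient topology. -/
instance : TopologicalSpace (TildeG P) :=
  inferInstanceAs (TopologicalSpace (Quotient (conjSetoid G Q)))

/-- The quotient map `ρ : Q × G → G̃`. -/
def rho (x : Q × G) : TildeG P := Quotient.mk (conjSetoid G Q) x

theorem rho_eq_iff {x y : Q × G} : rho P x = rho P y ↔ ∃ g : G, (g • y.1, g * y.2 * g⁻¹) = x :=
  Quotient.eq

theorem rho_smul (g : G) (q : Q) (w : G) : rho P (g • q, g * w * g⁻¹) = rho P (q, w) :=
  (rho_eq_iff P).2 ⟨g, rfl⟩

/-- The projection `G̃ → Q/G`. -/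
def pr (v : TildeG P) : Base G Q :=
  Quotient.lift (fun x : Q × G => proj G x.1)
    (by rintro _ b ⟨g, rfl⟩; exact proj_smul g b.1) v

@[simp] theorem pr_rho (x : Q × G) : pr P (rho P x) = proj G x.1 := rfl

theorem isQuotientMap_rho : Topology.IsQuotientMap (rho P) := isQuotientMap_quot_mk

theorem continuous_pr : Continuous (pr P) :=
  (isQuotientMap_rho P).continuous_iff.2 (P.smooth_proj.continuous.comp continuous_fst)

variable {P}

theorem theta_smul {U : Set (Base G Q)} {s : Base G Q → Q} {θ : Q → G}
    (P : PrincipalBundle EQ EG EB G Q)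
    (h : ∀ q, proj G q ∈ U → θ q • s (proj G q) = q) (g : G) (q : Q) (hq : proj G q ∈ U) :
    θ (g • q) = g * θ q := by
  have h1 := h q hq
  have h2 := h (g • q) (by rwa [proj_smul])
  rw [proj_smul] at h2
  have h3 : ((g * θ q)⁻¹ * θ (g • q)) • s (proj G q) = s (proj G q) := by
    rw [mul_smul, h2, mul_inv_rev, mul_smul, inv_smul_smul, inv_smul_eq_iff, h1]
  have := P.free _ _ h3
  rw [inv_mul_eq_one] at this
  exact this.symm

/-- A local trivialisation of the principal bundle. -/
structure LocalTriv (P : PrincipalBundle EQ EG EB G Q) where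
  /-- the open set over which the bundle is trivialised -/
  U : Set (Base G Q)
  /-- the local section -/
  s : Base G Q → Q
  /-- the group coordinate -/
  θ : Q → G
  isOpen : IsOpen U
  smooth_s : ContMDiffOn 𝓘(ℝ, EB) 𝓘(ℝ, EQ) ∞ s U
  proj_s : ∀ r ∈ U, proj G (s r) = r
  smooth_θ : ContMDiffOn 𝓘(ℝ, EQ) 𝓘(ℝ, EG) ∞ θ (proj G ⁻¹' U)
  θ_smul_s : ∀ q, proj G q ∈ U → θ q • s (proj G q) = q

theorem exists_localTriv (P : PrincipalBundle EQ EG EB G Q) (r : Base G Q) :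
    ∃ T : LocalTriv P, r ∈ T.U := by
  obtain ⟨U, s, θ, h1, h2, h3, h4, h5, h6⟩ := P.locally_trivial r
  exact ⟨⟨U, s, θ, h1, h3, h4, h5, h6⟩, h2⟩

/-- A chosen local trivialisation around a point. -/
def localTrivAt (P : PrincipalBundle EQ EG EB G Q) (r : Base G Q) : LocalTriv P :=
  (exists_localTriv P r).choose

theorem mem_localTrivAt (P : PrincipalBundle EQ EG EB G Q) (r : Base G Q) :
    r ∈ (localTrivAt P r).U :=
  (exists_localTriv P r).choose_spec

namespace LocalTriv

variable (T : LocalTriv P)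

theorem θ_s (r : Base G Q) (hr : r ∈ T.U) : T.θ (T.s r) = 1 := by
  have h := T.θ_smul_s (T.s r) (by rwa [T.proj_s r hr])
  rw [T.proj_s r hr] at h
  exact P.free _ _ h

open Classical in
/-- The group coordinate of `G̃` over `U`: the class of `(q, w)` has coordinate `θ(q)⁻¹ w θ(q)`. -/
def coord (v : TildeG P) : G :=
  Quotient.lift (fun x : Q × G => if proj G x.1 ∈ T.U then (T.θ x.1)⁻¹ * x.2 * T.θ x.1 else 1)
    (by
      rintro _ b ⟨g, rfl⟩
      by_cases hb : proj G b.1 ∈ T.U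
      · simp [proj_smul, hb, theta_smul P T.θ_smul_s, mul_assoc]
      · simp [proj_smul, hb]) v

theorem coord_rho (x : Q × G) (hx : proj G x.1 ∈ T.U) :
    T.coord (rho P x) = (T.θ x.1)⁻¹ * x.2 * T.θ x.1 := if_pos hx

variable [LieGroup 𝓘(ℝ, EG) ∞ G]

/-- The local trivialisation `v ↦ (pr v, coord v)` of `G̃` over `U`, with values in
`U × G` and inverse `(r, w) ↦ ρ(s r, w)`. -/
def conj : OpenPartialHomeomorph (TildeG P) (Base G Q × G) where
  toFun v := (pr P v, T.coord v)
  invFun x := rho P (T.s x.1, x.2)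
  source := pr P ⁻¹' T.U
  target := T.U ×ˢ univ
  map_source' v hv := ⟨hv, mem_univ _⟩
  map_target' x hx := by
    simp only [mem_preimage, pr_rho]
    rw [T.proj_s _ hx.1]; exact hx.1
  left_inv' v hv := by
    obtain ⟨x, rfl⟩ := (isQuotientMap_rho P).surjective v
    simp only [mem_preimage, pr_rho] at hv
    rw [T.coord_rho _ hv, pr_rho, rho_eq_iff]
    refine ⟨(T.θ x.1)⁻¹, ?_⟩
    have h := T.θ_smul_s _ hv
    simp only [inv_inv, Prod.mk.injEq, and_true]
    rw [inv_smul_eq_iff, h]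
  right_inv' x hx := by
    have h : proj G (T.s x.1) = x.1 := T.proj_s _ hx.1
    have h' : proj G (T.s x.1) ∈ T.U := by rw [h]; exact hx.1
    ext
    · simp [h]
    · simp only
      rw [T.coord_rho _ h']
      simp [T.θ_s _ hx.1]
  open_source := T.isOpen.preimage (continuous_pr P)
  open_target := T.isOpen.prod isOpen_univ
  continuousOn_toFun := by
    have : IsTopologicalGroup G := topologicalGroup_of_lieGroup 𝓘(ℝ, EG) ∞
    refine (continuous_pr P).continuousOn.prodMk ?_
    rw [(isQuotientMap_rho P).continuousOn_isOpen_iff (T.isOpen.preimage (continuous_pr P))]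
    have hθ : ContinuousOn (fun x : Q × G => T.θ x.1) (rho P ⁻¹' (pr P ⁻¹' T.U)) :=
      T.smooth_θ.continuousOn.comp continuousOn_fst (fun x hx => hx)
    refine ContinuousOn.congr ((hθ.inv.mul continuousOn_snd).mul hθ) ?_
    intro x hx
    exact T.coord_rho x hx
  continuousOn_invFun := by
    refine (isQuotientMap_rho P).continuous.comp_continuousOn ?_
    refine ContinuousOn.prodMk ?_ continuousOn_snd
    exact T.smooth_s.continuousOn.comp continuousOn_fst (fun x hx => hx.1)

end LocalTriv

variable [LieGroup 𝓘(ℝ, EG) ∞ G]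

/-- `G̃` is locally homeomorphic to `Q/G × G` through the local trivialisations. -/
@[reducible] def chartedSpaceProd (P : PrincipalBundle EQ EG EB G Q) :
    ChartedSpace (Base G Q × G) (TildeG P) where
  atlas := range fun T : LocalTriv P => T.conj
  chartAt v := (localTrivAt P (pr P v)).conj
  mem_chart_source _ := mem_localTrivAt P (pr P _)
  chart_mem_atlas _ := mem_range_self _

/-- The smooth atlas of `G̃`, modelled on `EB × EG`: the local trivialisations followed by charts
of `Q/G × G`. -/
instance : ChartedSpace (ModelProd EB EG) (TildeG P) :=
  letI := chartedSpaceProd P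
  ChartedSpace.comp (ModelProd EB EG) (Base G Q × G) (TildeG P)

theorem LocalTriv.smooth_transition (T T' : LocalTriv P) :
    ContMDiffOn (𝓘(ℝ, EB).prod 𝓘(ℝ, EG)) (𝓘(ℝ, EB).prod 𝓘(ℝ, EG)) ∞
      (T.conj.symm.trans T'.conj) (T.conj.symm.trans T'.conj).source := by
  have hsrc : ∀ x ∈ (T.conj.symm.trans T'.conj).source, x.1 ∈ T.U ∧ proj G (T.s x.1) ∈ T'.U := by
    rintro x ⟨hx1, hx2⟩
    exact ⟨hx1.1, hx2⟩
  have hs : ContMDiffOn (𝓘(ℝ, EB).prod 𝓘(ℝ, EG)) 𝓘(ℝ, EQ) ∞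
      (fun x : Base G Q × G => T.s x.1) (T.conj.symm.trans T'.conj).source :=
    T.smooth_s.comp contMDiffOn_fst (fun x hx => (hsrc x hx).1)
  have hθ : ContMDiffOn (𝓘(ℝ, EB).prod 𝓘(ℝ, EG)) 𝓘(ℝ, EG) ∞
      (fun x : Base G Q × G => T'.θ (T.s x.1)) (T.conj.symm.trans T'.conj).source :=
    T'.smooth_θ.comp hs (fun x hx => (hsrc x hx).2)
  refine (contMDiffOn_fst.prodMk ((hθ.inv.mul contMDiffOn_snd).mul hθ)).congr ?_
  intro x hx
  obtain ⟨h1, h2⟩ := hsrc x hx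
  change (proj G (T.s x.1), T'.coord (rho P (T.s x.1, x.2))) = _
  rw [T'.coord_rho _ h2, T.proj_s _ h1]
  rfl

instance [IsManifold 𝓘(ℝ, EB) ∞ (Base G Q)] :
    IsManifold (𝓘(ℝ, EB).prod 𝓘(ℝ, EG)) ∞ (TildeG P) := by
  have : IsManifold 𝓘(ℝ, EG) ∞ G := ContMDiffMul.toIsManifold
  apply isManifold_of_contDiffOn
  rintro _ _ ⟨_, ⟨T, rfl⟩, f, hf, rfl⟩ ⟨_, ⟨T', rfl⟩, f', hf', rfl⟩
  have key : ContMDiffOn (𝓘(ℝ, EB).prod 𝓘(ℝ, EG)) (𝓘(ℝ, EB).prod 𝓘(ℝ, EG)) ∞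
      (fun x => f' ((T.conj.symm.trans T'.conj) (f.symm x)))
      (((T.conj.trans f).symm).trans (T'.conj.trans f')).source := by
    refine (contMDiffOn_of_mem_maximalAtlas
      (IsManifold.subset_maximalAtlas hf')).comp ((LocalTriv.smooth_transition T T').comp
      ((contMDiffOn_symm_of_mem_maximalAtlas (IsManifold.subset_maximalAtlas hf)).mono ?_) ?_) ?_
    · rintro x ⟨⟨hx, _⟩, _⟩; exact hx
    · rintro x ⟨⟨_, hx⟩, hx', _⟩; exact ⟨hx, hx'⟩
    · rintro x ⟨⟨_, _⟩, _, hx⟩; exact hx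
  rw [contMDiffOn_iff] at key
  have h0 := key.2 ((0, 0) : EB × EG) ((0, 0) : EB × EG)
  refine (h0.mono ?_).congr ?_
  · rintro x ⟨hx, hx'⟩
    simp only [mfld_simps] at hx hx' ⊢
    tauto
  · rintro x -
    rfl

theorem contMDiff_rho  [IsManifold 𝓘(ℝ, EB) ∞ (Base G Q)] [IsManifold 𝓘(ℝ, EQ) ∞ Q] :
    ContMDiff (𝓘(ℝ, EQ).prod 𝓘(ℝ, EG)) (𝓘(ℝ, EB).prod 𝓘(ℝ, EG)) ∞ (rho P) := by
  intro x₀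
  have : IsManifold 𝓘(ℝ, EG) ∞ G := ContMDiffMul.toIsManifold
  rw [contMDiffAt_iff_target]
  refine ⟨(isQuotientMap_rho P).continuous.continuousAt, ?_⟩
  set T : LocalTriv P := localTrivAt P (pr P (rho P x₀)) with hT
  have hx₀ : proj G x₀.1 ∈ T.U := mem_localTrivAt P (pr P (rho P x₀))
  have hopen : IsOpen (proj G ⁻¹' T.U : Set Q) := T.isOpen.preimage P.smooth_proj.continuous
  have hnh : {x : Q × G | proj G x.1 ∈ T.U} ∈ 𝓝 x₀ :=
    (hopen.preimage continuous_fst).mem_nhds hx₀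
  have hθ : ContMDiffAt (𝓘(ℝ, EQ).prod 𝓘(ℝ, EG)) 𝓘(ℝ, EG) ∞ (fun x : Q × G => T.θ x.1) x₀ :=
    (T.smooth_θ.contMDiffAt (hopen.mem_nhds hx₀)).comp x₀ contMDiffAt_fst
  have h1 : ContMDiffAt (𝓘(ℝ, EQ).prod 𝓘(ℝ, EG)) (𝓘(ℝ, EB).prod 𝓘(ℝ, EG)) ∞
      (fun x : Q × G => (proj G x.1, (T.θ x.1)⁻¹ * x.2 * T.θ x.1)) x₀ :=
    ((P.smooth_proj _).comp x₀ contMDiffAt_fst).prodMk ((hθ.inv.mul contMDiffAt_snd).mul hθ)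
  have h2 := (contMDiffAt_extChartAt (I := 𝓘(ℝ, EB).prod 𝓘(ℝ, EG)) (n := ∞)
    (x := T.conj (rho P x₀)))
  have h3 : T.conj (rho P x₀) = (proj G x₀.1, (T.θ x₀.1)⁻¹ * x₀.2 * T.θ x₀.1) := by
    change (_, T.coord _) = _
    rw [T.coord_rho _ hx₀]; rfl
  have h4 := ContMDiffAt.comp_of_eq (x := x₀) h2 h1 h3.symm
  refine h4.congr_of_eventuallyEq ?_
  filter_upwards [hnh] with x hx
  have h5 : T.conj (rho P x) = (proj G x.1, (T.θ x.1)⁻¹ * x.2 * T.θ x.1) := by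
    change (_, T.coord _) = _
    rw [T.coord_rho _ hx]; rfl
  simp only [Function.comp]
  rw [← h5]
  rfl
end TildeG

end ConjBundle


/-! ### Discrete mechanical systems with symmetry -/

section Systems

variable (EQ EG G Q : Type*)
  [NormedAddCommGroup EQ] [NormedSpace ℝ EQ] [NormedAddCommGroup EG] [NormedSpace ℝ EG]
  [TopologicalSpace G] [ChartedSpace EG G] [Group G]
  [TopologicalSpace Q] [ChartedSpace EQ Q] [IsManifold 𝓘(ℝ, EQ) ∞ Q] [MulAction G Q]

/-- A nonholonomic discrete mechanical system `(Q, L_d, 𝒟, 𝒟_d)`. -/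
structure DiscreteSystem where
  /-- the discrete lagrangian -/
  Ld : Q × Q → ℝ
  /-- the variational constraints -/
  D : ∀ q : Q, Submodule ℝ (TangentSpace 𝓘(ℝ, EQ) q)
  /-- the discrete kinematic constraints -/
  Dd : Set (Q × Q)
  smooth_Ld : ContMDiff (𝓘(ℝ, EQ).prod 𝓘(ℝ, EQ)) 𝓘(ℝ, ℝ) ∞ Ld
  subbundle_D : IsSubbundle 𝓘(ℝ, EQ) D
  submanifold_Dd : IsSubmanifold (𝓘(ℝ, EQ).prod 𝓘(ℝ, EQ)) Dd

variable {EQ G Q} in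
/-- The differential at `q` of the action of `g`, a map `T_q Q → T_{gq} Q`. -/
def dAct (g : G) (q : Q) :
    TangentSpace 𝓘(ℝ, EQ) q →L[ℝ] TangentSpace 𝓘(ℝ, EQ) (g • q) :=
  mfderiv 𝓘(ℝ, EQ) 𝓘(ℝ, EQ) (fun x : Q => g • x) q

/-- A family of subspaces of the tangent spaces of `Q` is `G`-invariant. -/
def IsInvariant (D : ∀ q : Q, Submodule ℝ (TangentSpace 𝓘(ℝ, EQ) q)) : Prop :=
  ∀ (g : G) (q : Q), ∀ v ∈ D q, dAct g q v ∈ D (g • q)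

variable {Q} in
/-- The infinitesimal generator `ξ ↦ ξ_Q(q)`, the differential at `1` of `g ↦ g • q`. -/
def infGen (q : Q) : TangentSpace 𝓘(ℝ, EG) (1 : G) →L[ℝ] TangentSpace 𝓘(ℝ, EQ) q :=
  (mfderiv 𝓘(ℝ, EG) 𝓘(ℝ, EQ) (fun g : G => g • q) 1 : EG →L[ℝ] EQ)

variable {Q} in
/-- The vertical space `𝒱_q`, the tangent space of the orbit at `q`. -/
def vertical (q : Q) : Submodule ℝ (TangentSpace 𝓘(ℝ, EQ) q) :=
  LinearMap.range (infGen EQ EG G q).toLinearMap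

variable {EQ Q} in
/-- Invariance of `L_d`, `𝒟` and `𝒟_d` under `G`. -/
structure IsSymmetryGroup (sys : DiscreteSystem EQ Q) : Prop where
  Ld_smul : ∀ (g : G) (q₀ q₁ : Q), sys.Ld (g • q₀, g • q₁) = sys.Ld (q₀, q₁)
  Dd_smul : ∀ (g : G) (q₀ q₁ : Q), (q₀, q₁) ∈ sys.Dd → (g • q₀, g • q₁) ∈ sys.Dd
  D_smul : IsInvariant EQ G Q sys.D

variable {EQ Q} in
/-- A decomposition `TQ = 𝒲 ⊕ 𝒰 ⊕ 𝒮 ⊕ ℋ` into `G`-invariant subbundles, where `𝒮 = 𝒱 ∩ 𝒟`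
(assumed to be a subbundle), `𝒟 = 𝒮 ⊕ ℋ` and `𝒱 = 𝒮 ⊕ 𝒰`. -/
structure Splitting (sys : DiscreteSystem EQ Q) where
  /-- a complement of `𝒮` in `𝒟` -/
  H : ∀ q : Q, Submodule ℝ (TangentSpace 𝓘(ℝ, EQ) q)
  /-- a complement of `𝒮` in the vertical bundle -/
  U : ∀ q : Q, Submodule ℝ (TangentSpace 𝓘(ℝ, EQ) q)
  /-- a complement of `𝒟 + 𝒱` in `TQ` -/
  W : ∀ q : Q, Submodule ℝ (TangentSpace 𝓘(ℝ, EQ) q)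
  subbundle_S : IsSubbundle 𝓘(ℝ, EQ) fun q => vertical EQ EG G q ⊓ sys.D q
  subbundle_H : IsSubbundle 𝓘(ℝ, EQ) H
  subbundle_U : IsSubbundle 𝓘(ℝ, EQ) U
  subbundle_W : IsSubbundle 𝓘(ℝ, EQ) W
  invariant_H : IsInvariant EQ G Q H
  invariant_U : IsInvariant EQ G Q U
  invariant_W : IsInvariant EQ G Q W
  S_inf_H : ∀ q, (vertical EQ EG G q ⊓ sys.D q) ⊓ H q = ⊥
  S_sup_H : ∀ q, (vertical EQ EG G q ⊓ sys.D q) ⊔ H q = sys.D q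
  S_inf_U : ∀ q, (vertical EQ EG G q ⊓ sys.D q) ⊓ U q = ⊥
  S_sup_U : ∀ q, (vertical EQ EG G q ⊓ sys.D q) ⊔ U q = vertical EQ EG G q
  isCompl_W : ∀ q, IsCompl (sys.D q ⊔ vertical EQ EG G q) (W q)

/-- An affine discrete connection on `Q → Q/G` of level `γ`. -/
structure AffineDiscreteConnection where
  /-- the level -/
  γ : Q → G
  /-- the horizontal submanifold -/
  Hor : Set (Q × Q)
  smooth_γ : ContMDiff 𝓘(ℝ, EQ) 𝓘(ℝ, EG) ∞ γ
  γ_smul : ∀ (g : G) (q : Q), γ (g • q) = g * γ q * g⁻¹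
  submanifold_Hor : IsSubmanifold (𝓘(ℝ, EQ).prod 𝓘(ℝ, EQ)) Hor
  Hor_smul : ∀ (g : G) (q₀ q₁ : Q), (q₀, q₁) ∈ Hor → (g • q₀, g • q₁) ∈ Hor
  level_mem : ∀ q : Q, (q, γ q • q) ∈ Hor
  submanifold_fiber : ∀ q : Q, IsSubmanifold 𝓘(ℝ, EQ) {q₁ | (q, q₁) ∈ Hor}
  transversal : ∀ q q₁ : Q, q₁ ∈ MulAction.orbit G q → (q, q₁) ∈ Hor →
    IsCompl (vertical EQ EG G q₁) (tangentOf 𝓘(ℝ, EQ) {q' | (q, q') ∈ Hor} q₁)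

variable {EQ EG G Q} in
/-- A `G`-invariant open neighbourhood `U` of the level of an affine discrete connection. The
discrete connection form is the function sending `(q₀, q₁)` to the unique `g` such that
`(q₀, g⁻¹ q₁)` lies in the horizontal submanifold and in `U`, where there is such a `g`. -/
structure FormDomain (Ad : AffineDiscreteConnection EQ EG G Q) where
  /-- a neighbourhood of the level -/
  U : Set (Q × Q)
  isOpen_U : IsOpen U
  U_smul : ∀ (g : G) (q₀ q₁ : Q), (q₀, q₁) ∈ U → (g • q₀, g • q₁) ∈ U
  level_mem : ∀ q : Q, (q, Ad.γ q • q) ∈ U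

namespace FormDomain

variable {EQ EG G Q}
variable {Ad : AffineDiscreteConnection EQ EG G Q}

/-- The discrete connection form is defined, and smooth, over the open set `O` of pairs of points
of `Q/G`. -/
structure DefinedOver (dom : FormDomain Ad) (O : Set (Base G Q × Base G Q)) : Prop where
  isOpen : IsOpen O
  existsUnique : ∀ q₀ q₁ : Q, (proj G q₀, proj G q₁) ∈ O →
    ∃! g : G, (q₀, g⁻¹ • q₁) ∈ Ad.Hor ∩ dom.U
  smooth : ∀ A : Q × Q → G,
    (∀ q₀ q₁ : Q, (proj G q₀, proj G q₁) ∈ O → (q₀, (A (q₀, q₁))⁻¹ • q₁) ∈ Ad.Hor ∩ dom.U) →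
    ContMDiffOn (𝓘(ℝ, EQ).prod 𝓘(ℝ, EQ)) 𝓘(ℝ, EG) ∞ A {x | (proj G x.1, proj G x.2) ∈ O}

/-- The domain of the discrete connection form: the largest open set of pairs `(π q₀, π q₁)` over
which it is defined and smooth. -/
def W (dom : FormDomain Ad) : Set (Base G Q × Base G Q) := ⋃₀ {O | dom.DefinedOver O}

theorem isOpen_W (dom : FormDomain Ad) : IsOpen dom.W :=
  isOpen_sUnion fun _ hO => hO.isOpen

theorem existsUnique (dom : FormDomain Ad) (q₀ q₁ : Q) (h : (proj G q₀, proj G q₁) ∈ dom.W) :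
    ∃! g : G, (q₀, g⁻¹ • q₁) ∈ Ad.Hor ∩ dom.U := by
  obtain ⟨O, hO, hq⟩ := h
  exact hO.existsUnique q₀ q₁ hq

end FormDomain

end Systems

/-- The data of the reduction: a principal bundle `Q → Q/G`, a discrete mechanical system on `Q`
with symmetry group `G`, a splitting of `TQ` (which determines a connection on `Q → Q/G`)
and an affine discrete connection with a neighbourhood of its level. -/
structure ReductionData (EQ EG EB G Q : Type*)
    [NormedAddCommGroup EQ] [NormedSpace ℝ EQ] [NormedAddCommGroup EG] [NormedSpace ℝ EG]
    [NormedAddCommGroup EB] [NormedSpace ℝ EB]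
    [TopologicalSpace G] [ChartedSpace EG G] [Group G] [LieGroup 𝓘(ℝ, EG) ∞ G]
    [TopologicalSpace Q] [ChartedSpace EQ Q] [IsManifold 𝓘(ℝ, EQ) ∞ Q] [MulAction G Q]
    [ChartedSpace EB (Base G Q)] [IsManifold 𝓘(ℝ, EB) ∞ (Base G Q)] where
  bundle : PrincipalBundle EQ EG EB G Q
  sys : DiscreteSystem EQ Q
  symm : IsSymmetryGroup G sys
  split : Splitting EG G sys
  Ad : AffineDiscreteConnection EQ EG G Q
  dom : FormDomain Ad

namespace ReductionData

variable {EQ EG EB G Q : Type*}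
    [NormedAddCommGroup EQ] [NormedSpace ℝ EQ] [NormedAddCommGroup EG] [NormedSpace ℝ EG]
    [NormedAddCommGroup EB] [NormedSpace ℝ EB]
    [TopologicalSpace G] [ChartedSpace EG G] [Group G] [LieGroup 𝓘(ℝ, EG) ∞ G]
    [TopologicalSpace Q] [ChartedSpace EQ Q] [IsManifold 𝓘(ℝ, EQ) ∞ Q] [MulAction G Q]
    [ChartedSpace EB (Base G Q)] [IsManifold 𝓘(ℝ, EB) ∞ (Base G Q)]

/-! #### The group action -/

theorem contMDiff_smul (R : ReductionData EQ EG EB G Q) (g : G) :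
    ContMDiff 𝓘(ℝ, EQ) 𝓘(ℝ, EQ) ∞ (fun x : Q => g • x) :=
  R.bundle.smooth_smul.comp (contMDiff_const.prodMk contMDiff_id)

theorem mdiff_smul (R : ReductionData EQ EG EB G Q) (g : G) :
    MDifferentiable 𝓘(ℝ, EQ) 𝓘(ℝ, EQ) (fun x : Q => g • x) :=
  (R.contMDiff_smul g).mdifferentiable (by simp)

theorem mdiff_conj (g : G) :
    MDifferentiable 𝓘(ℝ, EG) 𝓘(ℝ, EG) (fun x : G => g * x * g⁻¹) := by
  have h : ContMDiff 𝓘(ℝ, EG) 𝓘(ℝ, EG) ∞ (fun x : G => g * x * g⁻¹) :=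
    (contMDiff_const.mul contMDiff_id).mul contMDiff_const
  exact h.mdifferentiable (by simp)

/-- The chain rule with the action of a group element, for an arbitrary function. -/
theorem mfderiv_comp_smul (R : ReductionData EQ EG EB G Q) {E H M : Type*} [NormedAddCommGroup E]
    [NormedSpace ℝ E] [TopologicalSpace H] {I : ModelWithCorners ℝ E H} [TopologicalSpace M]
    [ChartedSpace H M] (f : Q → M) (g : G) (q : Q) :
    mfderiv 𝓘(ℝ, EQ) I (fun x => f (g • x)) q = (mfderiv 𝓘(ℝ, EQ) I f (g • q)).comp (dAct g q) :=
  mfderiv_comp_right (R.mdiff_smul g) (R.mdiff_smul g⁻¹) (by simp) (by simp) q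

/-- The chain rule with a conjugation on the right, for an arbitrary function. -/
theorem mfderiv_comp_conj {E H M : Type*} [NormedAddCommGroup E]
    [NormedSpace ℝ E] [TopologicalSpace H] {I : ModelWithCorners ℝ E H} [TopologicalSpace M]
    [ChartedSpace H M] (f : G → M) (g w : G) :
    mfderiv 𝓘(ℝ, EG) I (fun x => f (g * x * g⁻¹)) w =
      (mfderiv 𝓘(ℝ, EG) I f (g * w * g⁻¹)).comp
        (mfderiv 𝓘(ℝ, EG) 𝓘(ℝ, EG) (fun x : G => g * x * g⁻¹) w) :=
  mfderiv_comp_right (φ := fun x : G => g * x * g⁻¹) (ψ := fun x : G => g⁻¹ * x * g)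
    (mdiff_conj g) (by simpa using mdiff_conj (EG := EG) g⁻¹) (by simp [mul_assoc])
    (by simp [mul_assoc]) w

/-- The chain rule with a conjugation on the left, for an arbitrary function. -/
theorem mfderiv_conj_comp {E H M : Type*} [NormedAddCommGroup E]
    [NormedSpace ℝ E] [TopologicalSpace H] {I : ModelWithCorners ℝ E H} [TopologicalSpace M]
    [ChartedSpace H M] (f : M → G) (g : G) (x : M) :
    mfderiv I 𝓘(ℝ, EG) (fun x => g * f x * g⁻¹) x =
      (mfderiv 𝓘(ℝ, EG) 𝓘(ℝ, EG) (fun x : G => g * x * g⁻¹) (f x)).comp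
        (mfderiv I 𝓘(ℝ, EG) f x) :=
  mfderiv_comp_left (φ := fun x : G => g * x * g⁻¹) (ψ := fun x : G => g⁻¹ * x * g)
    (mdiff_conj g) (by simpa using mdiff_conj (EG := EG) g⁻¹) (by simp [mul_assoc]) x

/-! #### The connection and its horizontal lift -/

/-- The differential `dπ(q) : T_q Q → T_{π q}(Q/G)`. -/
def dproj (_R : ReductionData EQ EG EB G Q) (q : Q) :
    TangentSpace 𝓘(ℝ, EQ) q →L[ℝ] TangentSpace 𝓘(ℝ, EB) (proj G q) :=
  mfderiv 𝓘(ℝ, EQ) 𝓘(ℝ, EB) (proj G) q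

theorem dproj_dAct (R : ReductionData EQ EG EB G Q) (g : G) (q : Q)
    (v : TangentSpace 𝓘(ℝ, EQ) q) :
    (R.dproj (g • q) (dAct g q v) : EB) = R.dproj q v := by
  have h := R.mfderiv_comp_smul (I := 𝓘(ℝ, EB)) (proj G : Q → Base G Q) g q
  have h' : (fun x : Q => proj G (g • x)) = (proj G : Q → Base G Q) := funext fun x => proj_smul g x
  have h2 : @Eq (EQ →L[ℝ] EB) (mfderiv 𝓘(ℝ, EQ) 𝓘(ℝ, EB) (fun x : Q => proj G (g • x)) q)
    (mfderiv 𝓘(ℝ, EQ) 𝓘(ℝ, EB) (proj G : Q → Base G Q) q) := mfderiv_congr h'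
  exact ((DFunLike.congr_fun h v).symm.trans (DFunLike.congr_fun h2 v))

theorem dproj_surjective (R : ReductionData EQ EG EB G Q) (q : Q) :
    Function.Surjective (R.dproj q) := by
  obtain ⟨T, hT⟩ := TildeG.exists_localTriv R.bundle (proj G q)
  have hs : MDifferentiableAt 𝓘(ℝ, EB) 𝓘(ℝ, EQ) (fun r => T.θ q • T.s r) (proj G q) :=
    (R.mdiff_smul (T.θ q) _).comp (proj G q)
      ((T.smooth_s.contMDiffAt (T.isOpen.mem_nhds hT)).mdifferentiableAt (by simp))
  have hq : T.θ q • T.s (proj G q) = q := T.θ_smul_s q hT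
  have hp : MDifferentiableAt 𝓘(ℝ, EQ) 𝓘(ℝ, EB) (proj G : Q → Base G Q) q :=
    (R.bundle.smooth_proj q).mdifferentiableAt (by simp)
  have hc := mfderiv_comp_of_eq hp hs hq
  have he : mfderiv 𝓘(ℝ, EB) 𝓘(ℝ, EB) ((proj G : Q → Base G Q) ∘ fun r => T.θ q • T.s r)
      (proj G q) = mfderiv 𝓘(ℝ, EB) 𝓘(ℝ, EB) (id : Base G Q → Base G Q) (proj G q) := by
    apply Filter.EventuallyEq.mfderiv_eq
    filter_upwards [T.isOpen.mem_nhds hT] with r hr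
    simp [proj_smul, T.proj_s r hr]
  intro u
  refine ⟨(mfderiv 𝓘(ℝ, EB) 𝓘(ℝ, EQ) (fun r => T.θ q • T.s r) (proj G q) u : EQ), ?_⟩
  have h1 := DFunLike.congr_fun hc u
  rw [he, mfderiv_id] at h1
  have h2 : @Eq (EQ →L[ℝ] EB)
    (mfderiv 𝓘(ℝ, EQ) 𝓘(ℝ, EB) (proj G : Q → Base G Q) (T.θ q • T.s (proj G q)))
    (mfderiv 𝓘(ℝ, EQ) 𝓘(ℝ, EB) (proj G : Q → Base G Q) q) := mfderiv_congr_point hq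
  exact ((DFunLike.congr_fun h2 _).symm.trans h1.symm)

theorem ker_dproj (R : ReductionData EQ EG EB G Q) (q : Q) :
    LinearMap.ker (R.dproj q).toLinearMap = vertical EQ EG G q := by
  have hact : MDifferentiable (𝓘(ℝ, EG).prod 𝓘(ℝ, EQ)) 𝓘(ℝ, EQ) (fun x : G × Q => x.1 • x.2) :=
    R.bundle.smooth_smul.mdifferentiable (by simp)
  have hpr : MDifferentiable 𝓘(ℝ, EQ) 𝓘(ℝ, EB) (proj G : Q → Base G Q) :=
    R.bundle.smooth_proj.mdifferentiable (by simp)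
  have horb : ∀ x : Q, MDifferentiable 𝓘(ℝ, EG) 𝓘(ℝ, EQ) (fun g : G => g • x) := fun x =>
    hact.comp (mdifferentiable_id.prodMk mdifferentiable_const)
  apply le_antisymm
  · intro v hv
    have hv : R.dproj q v = 0 := hv
    obtain ⟨T, hT⟩ := TildeG.exists_localTriv R.bundle (proj G q)
    have hopen : IsOpen (proj G ⁻¹' T.U : Set Q) :=
      T.isOpen.preimage R.bundle.smooth_proj.continuous
    have hθ : MDifferentiableAt 𝓘(ℝ, EQ) 𝓘(ℝ, EG) T.θ q :=
      (T.smooth_θ.contMDiffAt (hopen.mem_nhds hT)).mdifferentiableAt (by simp)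
    have hs : MDifferentiableAt 𝓘(ℝ, EB) 𝓘(ℝ, EQ) T.s (proj G q) :=
      (T.smooth_s.contMDiffAt (T.isOpen.mem_nhds hT)).mdifferentiableAt (by simp)
    have hsp : MDifferentiableAt 𝓘(ℝ, EQ) 𝓘(ℝ, EQ) (fun x => T.s (proj G x)) q :=
      hs.comp q (hpr q)
    have hq : T.θ q • T.s (proj G q) = q := T.θ_smul_s q hT
    have hq' : T.s (proj G q) = (T.θ q)⁻¹ • q := by rw [eq_inv_smul_iff, hq]
    -- the derivative of `x ↦ θ x • s (π x)`
    have e1 : (mfderiv 𝓘(ℝ, EQ) 𝓘(ℝ, EQ) (fun x => T.θ x • T.s (proj G x)) q v : EQ) = v := by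
      have : mfderiv 𝓘(ℝ, EQ) 𝓘(ℝ, EQ) (fun x => T.θ x • T.s (proj G x)) q =
          mfderiv 𝓘(ℝ, EQ) 𝓘(ℝ, EQ) (id : Q → Q) q := by
        apply Filter.EventuallyEq.mfderiv_eq
        filter_upwards [hopen.mem_nhds hT] with x hx
        exact T.θ_smul_s x hx
      rw [this, mfderiv_id]
      rfl
    have e2 := mfderiv_comp_apply q (hact (T.θ q, T.s (proj G q))) (hθ.prodMk hsp) v
    have e3 : (mfderiv 𝓘(ℝ, EQ) 𝓘(ℝ, EQ) (fun x => T.s (proj G x)) q v : EQ) = 0 := by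
      have := mfderiv_comp_apply q hs (hpr q) v
      refine this.trans ?_
      have h0 : mfderiv 𝓘(ℝ, EQ) 𝓘(ℝ, EB) (proj G : Q → Base G Q) q v = 0 := hv
      rw [h0]
      exact map_zero _
    rw [mfderiv_prod_eq_add_apply (hact (T.θ q, T.s (proj G q))), hθ.mfderiv_prod hsp] at e2
    have e4 : v = (mfderiv 𝓘(ℝ, EG) 𝓘(ℝ, EQ) (fun g : G => g • T.s (proj G q)) (T.θ q)
        (mfderiv 𝓘(ℝ, EQ) 𝓘(ℝ, EG) T.θ q v) : EQ) := by
      refine e1.symm.trans (e2.trans ?_)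
      refine (congrArg₂ (· + ·) rfl ?_).trans (add_zero _)
      refine (congrArg _ e3).trans ?_
      exact map_zero _
    -- the orbit map through `s (π q)` is a translate of the orbit map through `q`
    have hmul : MDifferentiable 𝓘(ℝ, EG) 𝓘(ℝ, EG) (fun g : G => g * (T.θ q)⁻¹) :=
      ((contMDiff_id.mul contMDiff_const : ContMDiff 𝓘(ℝ, EG) 𝓘(ℝ, EG) ∞
        (fun g : G => g * (T.θ q)⁻¹))).mdifferentiable (by simp)
    have e5 : (fun g : G => g • T.s (proj G q)) = (fun g : G => g • q) ∘ fun g => g * (T.θ q)⁻¹ := by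
      funext g
      simp only [Function.comp, mul_smul]
      rw [← hq']
    have e6 := mfderiv_comp_apply_of_eq (x := T.θ q) (horb q 1) (hmul (T.θ q))
      (mul_inv_cancel _) (mfderiv 𝓘(ℝ, EQ) 𝓘(ℝ, EG) T.θ q v)
    rw [← e5] at e6
    exact ⟨_, e6.symm.trans e4.symm⟩
  · rintro _ ⟨ξ, rfl⟩
    have h1 := mfderiv_comp_apply_of_eq (x := (1 : G)) (hpr q) (horb q 1) (one_smul G q) ξ
    have h2 : (proj G : Q → Base G Q) ∘ (fun g : G => g • q) = fun _ => proj G q := by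
      funext g
      exact proj_smul g q
    rw [h2, mfderiv_const] at h1
    exact h1.symm

/-- The horizontal space `𝒲_q ⊕ ℋ_q` of the nonholonomic connection. -/
def horizontal (R : ReductionData EQ EG EB G Q) (q : Q) : Submodule ℝ (TangentSpace 𝓘(ℝ, EQ) q) :=
  R.split.W q ⊔ R.split.H q

theorem isCompl_horizontal (R : ReductionData EQ EG EB G Q) (q : Q) :
    IsCompl (vertical EQ EG G q) (R.horizontal q) := by
  have hHD : R.split.H q ≤ R.sys.D q := by rw [← R.split.S_sup_H q]; exact le_sup_right
  constructor
  · rw [Submodule.disjoint_def]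
    intro x hxV hx
    obtain ⟨w, hw, h, hh, rfl⟩ := Submodule.mem_sup.1 hx
    have hw0 : w = 0 := by
      refine Submodule.disjoint_def.1 (R.split.isCompl_W q).disjoint w ?_ hw
      have : w = -h + (w + h) := by abel
      rw [this]
      exact Submodule.add_mem_sup (neg_mem (hHD hh)) hxV
    subst hw0
    rw [zero_add] at hxV ⊢
    have : h ∈ (vertical EQ EG G q ⊓ R.sys.D q) ⊓ R.split.H q := ⟨⟨hxV, hHD hh⟩, hh⟩
    rw [R.split.S_inf_H q] at this
    exact (Submodule.mem_bot ℝ).1 this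
  · rw [codisjoint_iff, eq_top_iff, ← (R.split.isCompl_W q).sup_eq_top, ← R.split.S_sup_H q]
    have h1 : vertical EQ EG G q ⊓ R.sys.D q ≤ vertical EQ EG G q := inf_le_left
    simp only [horizontal]
    refine sup_le (sup_le (sup_le (h1.trans le_sup_left) ?_) le_sup_left) ?_
    · exact le_sup_right.trans le_sup_right
    · exact le_sup_left.trans le_sup_right

theorem horizontal_dAct (R : ReductionData EQ EG EB G Q) (g : G) (q : Q)
    (v : TangentSpace 𝓘(ℝ, EQ) q) (hv : v ∈ R.horizontal q) :
    dAct g q v ∈ R.horizontal (g • q) := by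
  obtain ⟨w, hw, h, hh, rfl⟩ := Submodule.mem_sup.1 hv
  rw [map_add]
  exact Submodule.add_mem_sup (R.split.invariant_W g q w hw) (R.split.invariant_H g q h hh)

theorem bijective_dproj (R : ReductionData EQ EG EB G Q) (q : Q) :
    Function.Bijective ((R.dproj q).toLinearMap.domRestrict (R.horizontal q)) := by
  constructor
  · rw [← LinearMap.ker_eq_bot, LinearMap.ker_eq_bot']
    rintro ⟨v, hv⟩ h0
    have h1 : v ∈ vertical EQ EG G q := by rw [← R.ker_dproj q]; exact h0
    exact Subtype.ext (Submodule.disjoint_def.1 (R.isCompl_horizontal q).disjoint v h1 hv)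
  · intro u
    obtain ⟨v, rfl⟩ := R.dproj_surjective q u
    have hv : v ∈ vertical EQ EG G q ⊔ R.horizontal q := by
      rw [(R.isCompl_horizontal q).sup_eq_top]; trivial
    obtain ⟨x, hx, y, hy, rfl⟩ := Submodule.mem_sup.1 hv
    rw [← R.ker_dproj q] at hx
    refine ⟨⟨y, hy⟩, ?_⟩
    have hx : R.dproj q x = 0 := hx
    change R.dproj q y = R.dproj q (x + y)
    rw [map_add, hx, zero_add]

/-- The horizontal lift `h^q : T_{π q}(Q/G) → T_q Q` of the nonholonomic connection: the inverse
of the restriction of `dπ(q)` to the horizontal space. -/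
def hLift (R : ReductionData EQ EG EB G Q) (q : Q) :
    TangentSpace 𝓘(ℝ, EB) (proj G q) →ₗ[ℝ] TangentSpace 𝓘(ℝ, EQ) q :=
  (R.horizontal q).subtype ∘ₗ
    (LinearEquiv.ofBijective _ (R.bijective_dproj q)).symm.toLinearMap

theorem hLift_mem (R : ReductionData EQ EG EB G Q) (q : Q)
    (u : TangentSpace 𝓘(ℝ, EB) (proj G q)) : R.hLift q u ∈ R.horizontal q :=
  ((LinearEquiv.ofBijective _ (R.bijective_dproj q)).symm u).2

theorem dproj_hLift (R : ReductionData EQ EG EB G Q) (q : Q)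
    (u : TangentSpace 𝓘(ℝ, EB) (proj G q)) : R.dproj q (R.hLift q u) = u :=
  (LinearEquiv.ofBijective _ (R.bijective_dproj q)).apply_symm_apply u

theorem hLift_unique (R : ReductionData EQ EG EB G Q) (q : Q)
    (v : TangentSpace 𝓘(ℝ, EQ) q) (hv : v ∈ R.horizontal q) : R.hLift q (R.dproj q v) = v :=
  congrArg Subtype.val ((LinearEquiv.ofBijective _ (R.bijective_dproj q)).symm_apply_apply ⟨v, hv⟩)

/-- The horizontal lift is `G`-equivariant. -/
theorem hLift_smul (R : ReductionData EQ EG EB G Q) (g : G) (q : Q) (u : EB) :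
    (R.hLift (g • q) u : EQ) = dAct g q (R.hLift q u) := by
  have h1 := R.hLift_unique (g • q) _ (R.horizontal_dAct g q _ (R.hLift_mem q u))
  have h2 : (R.dproj (g • q) (dAct g q (R.hLift q u)) : EB) = u :=
    (R.dproj_dAct g q _).trans (R.dproj_hLift q u)
  exact (congrArg (fun z : EB => (R.hLift (g • q) z : EQ)) h2).symm.trans h1

/-- The reduced variational constraints `𝒟̂_r = dπ(q)(𝒟_q)`, for any `q` with `π q = r`. -/
def Dhat (R : ReductionData EQ EG EB G Q) (r : Base G Q) :
    Submodule ℝ (TangentSpace 𝓘(ℝ, EB) r) :=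
  Quotient.lift (s := MulAction.orbitRel G Q)
    (fun q : Q => ((R.sys.D q).map (R.dproj q).toLinearMap : Submodule ℝ EB))
    (by
      have key : ∀ (g : G) (q : Q), ((R.sys.D q).map (R.dproj q).toLinearMap : Submodule ℝ EB) ≤
          ((R.sys.D (g • q)).map (R.dproj (g • q)).toLinearMap : Submodule ℝ EB) := by
        rintro g q _ ⟨v, hv, rfl⟩
        exact ⟨dAct g q v, R.symm.D_smul g q v hv, R.dproj_dAct g q v⟩
      rintro _ b ⟨g, rfl⟩
      apply le_antisymm
      · have := key g⁻¹ (g • b)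
        rwa [inv_smul_smul] at this
      · exact key g b) r

/-- The fibre `𝔤^𝒟_q = {ξ | ξ_Q(q) ∈ 𝒟_q}`. -/
def gD (R : ReductionData EQ EG EB G Q) (q : Q) : Submodule ℝ (TangentSpace 𝓘(ℝ, EG) (1 : G)) :=
  (R.sys.D q).comap (infGen EQ EG G q).toLinearMap

/-! #### The discrete connection form and the discrete horizontal lift -/

open Classical in
/-- The discrete connection form `𝒜_d : Q × Q → G` (equal to `1` outside of its domain). -/
def form (R : ReductionData EQ EG EB G Q) (x : Q × Q) : G :=
  if h : (proj G x.1, proj G x.2) ∈ R.dom.W then (R.dom.existsUnique x.1 x.2 h).choose else 1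

theorem form_spec (R : ReductionData EQ EG EB G Q) (q₀ q₁ : Q)
    (h : (proj G q₀, proj G q₁) ∈ R.dom.W) :
    (q₀, (R.form (q₀, q₁))⁻¹ • q₁) ∈ R.Ad.Hor ∩ R.dom.U := by
  rw [form, dif_pos h]
  exact (R.dom.existsUnique q₀ q₁ h).choose_spec.1

theorem form_unique (R : ReductionData EQ EG EB G Q) (q₀ q₁ : Q)
    (h : (proj G q₀, proj G q₁) ∈ R.dom.W) (g : G)
    (hg : (q₀, g⁻¹ • q₁) ∈ R.Ad.Hor ∩ R.dom.U) : R.form (q₀, q₁) = g :=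
  (R.dom.existsUnique q₀ q₁ h).unique (R.form_spec q₀ q₁ h) hg

theorem form_smul (R : ReductionData EQ EG EB G Q) (g : G) (q₀ q₁ : Q) :
    R.form (g • q₀, g • q₁) = g * R.form (q₀, q₁) * g⁻¹ := by
  by_cases h : (proj G q₀, proj G q₁) ∈ R.dom.W
  · refine R.form_unique _ _ (by simpa only [proj_smul] using h) _ ?_
    have h1 := R.form_spec q₀ q₁ h
    have h2 : (g * R.form (q₀, q₁) * g⁻¹)⁻¹ • g • q₁ = g • (R.form (q₀, q₁))⁻¹ • q₁ := by
      simp [smul_smul, mul_assoc]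
    rw [h2]
    exact ⟨R.Ad.Hor_smul g _ _ h1.1, R.dom.U_smul g _ _ h1.2⟩
  · have h' : (proj G (g • q₀), proj G (g • q₁)) ∉ R.dom.W := by simpa only [proj_smul] using h
    rw [form, form, dif_neg h, dif_neg h']
    simp

theorem existsUnique_dLift (R : ReductionData EQ EG EB G Q) (q₀ : Q) (r₁ : Base G Q)
    (h : (proj G q₀, r₁) ∈ R.dom.W) :
    ∃! q₁ : Q, (q₀, q₁) ∈ R.Ad.Hor ∩ R.dom.U ∧ proj G q₁ = r₁ := by
  obtain ⟨q₁, rfl⟩ : ∃ q, proj G q = r₁ := Quotient.exists_rep r₁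
  refine ⟨(R.form (q₀, q₁))⁻¹ • q₁, ⟨R.form_spec q₀ q₁ h, proj_smul _ _⟩, ?_⟩
  rintro q' ⟨hq', hp⟩
  obtain ⟨g, rfl⟩ := proj_eq_iff.1 hp
  rw [R.form_unique q₀ q₁ h g⁻¹ (by rwa [inv_inv]), inv_inv]

open Classical in
/-- The second component of the discrete horizontal lift: for `(π q₀, r₁)` in the domain it
is the `q₁` with `(q₀, q₁)` horizontal and `π q₁ = r₁` (and it is `q₀` outside of the domain). -/
def dLift (R : ReductionData EQ EG EB G Q) (q₀ : Q) (r₁ : Base G Q) : Q :=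
  if h : (proj G q₀, r₁) ∈ R.dom.W then (R.existsUnique_dLift q₀ r₁ h).choose else q₀

theorem dLift_spec (R : ReductionData EQ EG EB G Q) (q₀ : Q) (r₁ : Base G Q)
    (h : (proj G q₀, r₁) ∈ R.dom.W) :
    (q₀, R.dLift q₀ r₁) ∈ R.Ad.Hor ∩ R.dom.U ∧ proj G (R.dLift q₀ r₁) = r₁ := by
  rw [dLift, dif_pos h]
  exact (R.existsUnique_dLift q₀ r₁ h).choose_spec.1

theorem dLift_smul (R : ReductionData EQ EG EB G Q) (g : G) (q₀ : Q) (r₁ : Base G Q) :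
    R.dLift (g • q₀) r₁ = g • R.dLift q₀ r₁ := by
  by_cases h : (proj G q₀, r₁) ∈ R.dom.W
  · have h' : (proj G (g • q₀), r₁) ∈ R.dom.W := by rwa [proj_smul]
    refine (R.existsUnique_dLift _ _ h').unique (R.dLift_spec _ _ h') ?_
    have h1 := R.dLift_spec q₀ r₁ h
    exact ⟨⟨R.Ad.Hor_smul g _ _ h1.1.1, R.dom.U_smul g _ _ h1.1.2⟩, by rw [proj_smul, h1.2]⟩
  · have h' : (proj G (g • q₀), r₁) ∉ R.dom.W := by rwa [proj_smul]
    rw [dLift, dLift, dif_neg h, dif_neg h']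

/-- The map `F̃₁(q₀, w₀, r₁) = w₀ • dLift q₀ r₁`. -/
def F₁ (R : ReductionData EQ EG EB G Q) (q₀ : Q) (w₀ : G) (r₁ : Base G Q) : Q :=
  w₀ • R.dLift q₀ r₁

theorem F₁_smul (R : ReductionData EQ EG EB G Q) (g : G) (q₀ : Q) (w₀ : G) (r₁ : Base G Q) :
    R.F₁ (g • q₀) (g * w₀ * g⁻¹) r₁ = g • R.F₁ q₀ w₀ r₁ := by
  simp [F₁, R.dLift_smul, mul_smul]

theorem form_F₁ (R : ReductionData EQ EG EB G Q) (q₀ : Q) (w₀ : G) (r₁ : Base G Q)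
    (h : (proj G q₀, r₁) ∈ R.dom.W) : R.form (q₀, R.F₁ q₀ w₀ r₁) = w₀ := by
  have h1 := R.dLift_spec q₀ r₁ h
  refine R.form_unique _ _ (by rw [F₁, proj_smul, h1.2]; exact h) _ ?_
  rw [F₁, inv_smul_smul]
  exact h1.1

/-- The reduced space `G̃`. -/
abbrev Tilde (R : ReductionData EQ EG EB G Q) : Type _ := TildeG R.bundle

/-- The quotient map `ρ : Q × G → G̃`. -/
abbrev rho (R : ReductionData EQ EG EB G Q) (x : Q × G) : R.Tilde := TildeG.rho R.bundle x

/-- The map `Υ(q₀, q₁) = (ρ(q₀, 𝒜_d(q₀, q₁)), π(q₁))`. -/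
def Upsilon (R : ReductionData EQ EG EB G Q) (x : Q × Q) : R.Tilde × Base G Q :=
  (R.rho (x.1, R.form x), proj G x.2)

/-- The reduced kinematic constraints: the image of `𝒟_d` (within the domain of the
discrete connection form) in `G̃ × Q/G`. -/
def DdHat (R : ReductionData EQ EG EB G Q) : Set (R.Tilde × Base G Q) :=
  R.Upsilon '' {x | x ∈ R.sys.Dd ∧ (proj G x.1, proj G x.2) ∈ R.dom.W}

/-! #### Lagrangians, actions and forces -/

/-- `D₁L_d(q₀, q₁)`. -/
def D₁Ld (R : ReductionData EQ EG EB G Q) (q₀ q₁ : Q) : TangentSpace 𝓘(ℝ, EQ) q₀ →L[ℝ] ℝ :=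
  mfderiv 𝓘(ℝ, EQ) 𝓘(ℝ, ℝ) (fun q => R.sys.Ld (q, q₁)) q₀

/-- `D₂L_d(q₀, q₁)`. -/
def D₂Ld (R : ReductionData EQ EG EB G Q) (q₀ q₁ : Q) : TangentSpace 𝓘(ℝ, EQ) q₁ →L[ℝ] ℝ :=
  mfderiv 𝓘(ℝ, EQ) 𝓘(ℝ, ℝ) (fun q => R.sys.Ld (q₀, q)) q₁

/-- The differential `dL_d(q₀, q₁)`. -/
def dLd (R : ReductionData EQ EG EB G Q) (q₀ q₁ : Q) (v₀ : TangentSpace 𝓘(ℝ, EQ) q₀)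
    (v₁ : TangentSpace 𝓘(ℝ, EQ) q₁) : ℝ :=
  mfderiv (𝓘(ℝ, EQ).prod 𝓘(ℝ, EQ)) 𝓘(ℝ, ℝ) R.sys.Ld (q₀, q₁) (v₀, v₁)

/-- The differential of the discrete action `S_d(q) = ∑_{k < N} L_d(q_k, q_{k+1})` of a discrete
curve `q_0, …, q_N`, evaluated at a variation. -/
def dAction (R : ReductionData EQ EG EB G Q) (N : ℕ) (q : ℕ → Q)
    (δq : ∀ k, TangentSpace 𝓘(ℝ, EQ) (q k)) : ℝ :=
  ∑ k ∈ Finset.range N, R.dLd (q k) (q (k + 1)) (δq k) (δq (k + 1))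

/-- The lagrangian `Ľ_d(q₀, w₀, r₁) = L_d(q₀, F̃₁(q₀, w₀, r₁))` on `Q × G × Q/G`. -/
def Lcheck (R : ReductionData EQ EG EB G Q) (q₀ : Q) (w₀ : G) (r₁ : Base G Q) : ℝ :=
  R.sys.Ld (q₀, R.F₁ q₀ w₀ r₁)

theorem Lcheck_smul (R : ReductionData EQ EG EB G Q) (g : G) (q₀ : Q) (w₀ : G) (r₁ : Base G Q) :
    R.Lcheck (g • q₀) (g * w₀ * g⁻¹) r₁ = R.Lcheck q₀ w₀ r₁ := by
  rw [Lcheck, R.F₁_smul, R.symm.Ld_smul, Lcheck]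

/-- The reduced lagrangian `L̂_d` on `G̃ × Q/G`. -/
def Lhat (R : ReductionData EQ EG EB G Q) (x : R.Tilde × Base G Q) : ℝ :=
  Quotient.lift (s := conjSetoid G Q) (fun a : Q × G => R.Lcheck a.1 a.2 x.2)
    (by rintro _ b ⟨g, rfl⟩; exact R.Lcheck_smul g b.1 b.2 x.2) x.1

/-- `D₁Ľ_d(q₀, w₀, r₁)`. -/
def D₁L (R : ReductionData EQ EG EB G Q) (q₀ : Q) (w₀ : G) (r₁ : Base G Q) :
    TangentSpace 𝓘(ℝ, EQ) q₀ →L[ℝ] ℝ :=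
  mfderiv 𝓘(ℝ, EQ) 𝓘(ℝ, ℝ) (fun q => R.Lcheck q w₀ r₁) q₀

/-- `D₂Ľ_d(q₀, w₀, r₁)`. -/
def D₂L (R : ReductionData EQ EG EB G Q) (q₀ : Q) (w₀ : G) (r₁ : Base G Q) :
    TangentSpace 𝓘(ℝ, EG) w₀ →L[ℝ] ℝ :=
  mfderiv 𝓘(ℝ, EG) 𝓘(ℝ, ℝ) (fun w => R.Lcheck q₀ w r₁) w₀

/-- `D₃Ľ_d(q₀, w₀, r₁)`. -/
def D₃L (R : ReductionData EQ EG EB G Q) (q₀ : Q) (w₀ : G) (r₁ : Base G Q) :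
    TangentSpace 𝓘(ℝ, EB) r₁ →L[ℝ] ℝ :=
  mfderiv 𝓘(ℝ, EB) 𝓘(ℝ, ℝ) (fun r => R.Lcheck q₀ w₀ r) r₁

/-- `D₁𝒜_d(q₀, q₁)`. -/
def D₁A (R : ReductionData EQ EG EB G Q) (q₀ q₁ : Q) :
    TangentSpace 𝓘(ℝ, EQ) q₀ →L[ℝ] TangentSpace 𝓘(ℝ, EG) (R.form (q₀, q₁)) :=
  mfderiv 𝓘(ℝ, EQ) 𝓘(ℝ, EG) (fun q => R.form (q, q₁)) q₀

/-- `D₂𝒜_d(q₀, q₁)`. -/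
def D₂A (R : ReductionData EQ EG EB G Q) (q₀ q₁ : Q) :
    TangentSpace 𝓘(ℝ, EQ) q₁ →L[ℝ] TangentSpace 𝓘(ℝ, EG) (R.form (q₀, q₁)) :=
  mfderiv 𝓘(ℝ, EQ) 𝓘(ℝ, EG) (fun q => R.form (q₀, q)) q₁

/-- The differential `d𝒜_d(q₀, q₁)` of the discrete connection form. -/
def dA (R : ReductionData EQ EG EB G Q) (q₀ q₁ : Q) (v₀ : TangentSpace 𝓘(ℝ, EQ) q₀)
    (v₁ : TangentSpace 𝓘(ℝ, EQ) q₁) : TangentSpace 𝓘(ℝ, EG) (R.form (q₀, q₁)) :=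
  mfderiv (𝓘(ℝ, EQ).prod 𝓘(ℝ, EQ)) 𝓘(ℝ, EG) R.form (q₀, q₁) (v₀, v₁)

/-- The differential `dρ(q, w)`. -/
def dRho (R : ReductionData EQ EG EB G Q) (q : Q) (w : G) (v : TangentSpace 𝓘(ℝ, EQ) q)
    (u : TangentSpace 𝓘(ℝ, EG) w) :
    TangentSpace (𝓘(ℝ, EB).prod 𝓘(ℝ, EG)) (R.rho (q, w)) :=
  mfderiv (𝓘(ℝ, EQ).prod 𝓘(ℝ, EG)) (𝓘(ℝ, EB).prod 𝓘(ℝ, EG)) R.rho (q, w) (v, u)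

/-- The differential `dL̂_d(v, r)`. -/
def dLhat (R : ReductionData EQ EG EB G Q) (v : R.Tilde) (r : Base G Q)
    (δv : TangentSpace (𝓘(ℝ, EB).prod 𝓘(ℝ, EG)) v) (δr : TangentSpace 𝓘(ℝ, EB) r) : ℝ :=
  mfderiv ((𝓘(ℝ, EB).prod 𝓘(ℝ, EG)).prod 𝓘(ℝ, EB)) 𝓘(ℝ, ℝ) R.Lhat (v, r) (δv, δr)

/-- The differential of the reduced action `Ŝ_d(v, r) = ∑_{k < N} L̂_d(v_k, r_{k+1})`, evaluated
at a variation. -/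
def dActionHat (R : ReductionData EQ EG EB G Q) (N : ℕ) (v : ℕ → R.Tilde) (r : ℕ → Base G Q)
    (δv : ∀ k, TangentSpace (𝓘(ℝ, EB).prod 𝓘(ℝ, EG)) (v k))
    (δr : ∀ k, TangentSpace 𝓘(ℝ, EB) (r k)) : ℝ :=
  ∑ k ∈ Finset.range N, R.dLhat (v k) (r (k + 1)) (δv k) (δr (k + 1))

theorem D₁L_smul (R : ReductionData EQ EG EB G Q) (g : G) (q₀ : Q) (w₀ : G) (r₁ : Base G Q)
    (v : TangentSpace 𝓘(ℝ, EQ) q₀) :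
    R.D₁L (g • q₀) (g * w₀ * g⁻¹) r₁ (dAct g q₀ v) = R.D₁L q₀ w₀ r₁ v := by
  have h := R.mfderiv_comp_smul (I := 𝓘(ℝ, ℝ)) (fun q => R.Lcheck q (g * w₀ * g⁻¹) r₁) g q₀
  have h' : (fun x : Q => R.Lcheck (g • x) (g * w₀ * g⁻¹) r₁) = fun x => R.Lcheck x w₀ r₁ :=
    funext fun x => R.Lcheck_smul g x w₀ r₁
  rw [h'] at h
  exact (DFunLike.congr_fun h v).symm

theorem D₂L_smul (R : ReductionData EQ EG EB G Q) (g : G) (q₀ : Q) (w₀ : G) (r₁ : Base G Q)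
    (u : TangentSpace 𝓘(ℝ, EG) w₀) :
    R.D₂L (g • q₀) (g * w₀ * g⁻¹) r₁
      (mfderiv 𝓘(ℝ, EG) 𝓘(ℝ, EG) (fun x : G => g * x * g⁻¹) w₀ u) = R.D₂L q₀ w₀ r₁ u := by
  have h := mfderiv_comp_conj (EG := EG) (I := 𝓘(ℝ, ℝ)) (fun w => R.Lcheck (g • q₀) w r₁) g w₀
  have h' : (fun x : G => R.Lcheck (g • q₀) (g * x * g⁻¹) r₁) = fun x => R.Lcheck q₀ x r₁ :=
    funext fun x => R.Lcheck_smul g q₀ x r₁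
  rw [h'] at h
  exact (DFunLike.congr_fun h u).symm

theorem D₃L_smul (R : ReductionData EQ EG EB G Q) (g : G) (q₀ : Q) (w₀ : G) (r₁ : Base G Q) :
    R.D₃L (g • q₀) (g * w₀ * g⁻¹) r₁ = R.D₃L q₀ w₀ r₁ := by
  unfold D₃L
  rw [funext fun r => R.Lcheck_smul g q₀ w₀ r]

theorem D₁A_smul (R : ReductionData EQ EG EB G Q) (g : G) (q₀ q₁ : Q)
    (v : TangentSpace 𝓘(ℝ, EQ) q₀) :
    (R.D₁A (g • q₀) (g • q₁) (dAct g q₀ v) : EG) =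
      mfderiv 𝓘(ℝ, EG) 𝓘(ℝ, EG) (fun x : G => g * x * g⁻¹) (R.form (q₀, q₁)) (R.D₁A q₀ q₁ v) := by
  have h := R.mfderiv_comp_smul (I := 𝓘(ℝ, EG)) (fun q => R.form (q, g • q₁)) g q₀
  have h' : (fun x : Q => R.form (g • x, g • q₁)) = fun x => g * R.form (x, q₁) * g⁻¹ :=
    funext fun x => R.form_smul g x q₁
  have h2 := mfderiv_conj_comp (EG := EG) (I := 𝓘(ℝ, EQ)) (fun x => R.form (x, q₁)) g q₀
  have h3 : @Eq (EQ →L[ℝ] EG) _ _ := mfderiv_congr (I := 𝓘(ℝ, EQ)) (I' := 𝓘(ℝ, EG)) (x := q₀) h'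
  exact (DFunLike.congr_fun h v).symm.trans
    ((DFunLike.congr_fun h3 v).trans (DFunLike.congr_fun h2 v))

theorem D₂A_smul (R : ReductionData EQ EG EB G Q) (g : G) (q₀ q₁ : Q)
    (v : TangentSpace 𝓘(ℝ, EQ) q₁) :
    (R.D₂A (g • q₀) (g • q₁) (dAct g q₁ v) : EG) =
      mfderiv 𝓘(ℝ, EG) 𝓘(ℝ, EG) (fun x : G => g * x * g⁻¹) (R.form (q₀, q₁)) (R.D₂A q₀ q₁ v) := by
  have h := R.mfderiv_comp_smul (I := 𝓘(ℝ, EG)) (fun q => R.form (g • q₀, q)) g q₁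
  have h' : (fun x : Q => R.form (g • q₀, g • x)) = fun x => g * R.form (q₀, x) * g⁻¹ :=
    funext fun x => R.form_smul g q₀ x
  have h2 := mfderiv_conj_comp (EG := EG) (I := 𝓘(ℝ, EQ)) (fun x => R.form (q₀, x)) g q₁
  have h3 : @Eq (EQ →L[ℝ] EG) _ _ := mfderiv_congr (I := 𝓘(ℝ, EQ)) (I' := 𝓘(ℝ, EG)) (x := q₁) h'
  exact (DFunLike.congr_fun h v).symm.trans
    ((DFunLike.congr_fun h3 v).trans (DFunLike.congr_fun h2 v))

open Classical in
/-- The linear form `D₂Ľ_d(q₀, w₀, r₁) ∘ D₁𝒜_d(q₀, q₁) ∘ h^{q₀}` with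
`q₁ = F̃₁(q₀, w₀, r₁)`, on `T_{π q₀}(Q/G)` (zero outside of the domain). -/
def forceMinusAux (R : ReductionData EQ EG EB G Q) (q₀ : Q) (w₀ : G) (r₁ : Base G Q) :
    EB →ₗ[ℝ] ℝ :=
  if (proj G q₀, r₁) ∈ R.dom.W then
    (R.D₂L q₀ w₀ r₁ : EG →L[ℝ] ℝ).toLinearMap ∘ₗ
      (R.D₁A q₀ (R.F₁ q₀ w₀ r₁) : EQ →L[ℝ] EG).toLinearMap ∘ₗ (R.hLift q₀ : EB →ₗ[ℝ] EQ)
  else 0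

open Classical in
/-- The linear form `D₂Ľ_d(q₀, w₀, r₁) ∘ D₂𝒜_d(q₀, q₁) ∘ h^{q₁}` with
`q₁ = F̃₁(q₀, w₀, r₁)`, on `T_{r₁}(Q/G)` (zero outside of the domain). -/
def forcePlusAux (R : ReductionData EQ EG EB G Q) (q₀ : Q) (w₀ : G) (r₁ : Base G Q) :
    EB →ₗ[ℝ] ℝ :=
  if (proj G q₀, r₁) ∈ R.dom.W then
    (R.D₂L q₀ w₀ r₁ : EG →L[ℝ] ℝ).toLinearMap ∘ₗ
      (R.D₂A q₀ (R.F₁ q₀ w₀ r₁) : EQ →L[ℝ] EG).toLinearMap ∘ₗ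
      (R.hLift (R.F₁ q₀ w₀ r₁) : EB →ₗ[ℝ] EQ)
  else 0

theorem forceMinusAux_smul (R : ReductionData EQ EG EB G Q) (g : G) (q₀ : Q) (w₀ : G)
    (r₁ : Base G Q) :
    R.forceMinusAux (g • q₀) (g * w₀ * g⁻¹) r₁ = R.forceMinusAux q₀ w₀ r₁ := by
  by_cases h : (proj G q₀, r₁) ∈ R.dom.W
  · have h' : (proj G (g • q₀), r₁) ∈ R.dom.W := by rwa [proj_smul]
    rw [forceMinusAux, forceMinusAux, if_pos h, if_pos h']
    ext u
    have e1 := R.D₁A_smul g q₀ (R.F₁ q₀ w₀ r₁) (R.hLift q₀ u)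
    rw [R.form_F₁ q₀ w₀ r₁ h, ← R.F₁_smul] at e1
    have e2 := R.D₂L_smul g q₀ w₀ r₁ (R.D₁A q₀ (R.F₁ q₀ w₀ r₁) (R.hLift q₀ u) : EG)
    refine Eq.trans ?_ e2
    refine congrArg (R.D₂L (g • q₀) (g * w₀ * g⁻¹) r₁ : EG → ℝ) ?_
    refine Eq.trans ?_ e1
    exact congrArg (R.D₁A (g • q₀) (R.F₁ (g • q₀) (g * w₀ * g⁻¹) r₁) : EQ → EG)
      (R.hLift_smul g q₀ u)
  · have h' : (proj G (g • q₀), r₁) ∉ R.dom.W := by rwa [proj_smul]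
    rw [forceMinusAux, forceMinusAux, if_neg h, if_neg h']

theorem forcePlusAux_smul (R : ReductionData EQ EG EB G Q) (g : G) (q₀ : Q) (w₀ : G)
    (r₁ : Base G Q) :
    R.forcePlusAux (g • q₀) (g * w₀ * g⁻¹) r₁ = R.forcePlusAux q₀ w₀ r₁ := by
  by_cases h : (proj G q₀, r₁) ∈ R.dom.W
  · have h' : (proj G (g • q₀), r₁) ∈ R.dom.W := by rwa [proj_smul]
    rw [forcePlusAux, forcePlusAux, if_pos h, if_pos h']
    ext u
    have e1 := R.D₂A_smul g q₀ (R.F₁ q₀ w₀ r₁) (R.hLift (R.F₁ q₀ w₀ r₁) u)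
    rw [R.form_F₁ q₀ w₀ r₁ h] at e1
    have e2 := R.D₂L_smul g q₀ w₀ r₁
      (R.D₂A q₀ (R.F₁ q₀ w₀ r₁) (R.hLift (R.F₁ q₀ w₀ r₁) u) : EG)
    rw [R.F₁_smul]
    refine Eq.trans ?_ e2
    refine congrArg (R.D₂L (g • q₀) (g * w₀ * g⁻¹) r₁ : EG → ℝ) ?_
    refine Eq.trans ?_ e1
    exact congrArg (R.D₂A (g • q₀) (g • R.F₁ q₀ w₀ r₁) : EQ → EG)
      (R.hLift_smul g (R.F₁ q₀ w₀ r₁) u)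
  · have h' : (proj G (g • q₀), r₁) ∉ R.dom.W := by rwa [proj_smul]
    rw [forcePlusAux, forcePlusAux, if_neg h, if_neg h']

/-- The component `F̂_d⁻(v₀, r₁)` of the reduced discrete force. -/
def forceMinus (R : ReductionData EQ EG EB G Q) (v₀ : R.Tilde) (r₁ : Base G Q) :
    TangentSpace 𝓘(ℝ, EB) (TildeG.pr R.bundle v₀) →ₗ[ℝ] ℝ :=
  (Quotient.lift (s := conjSetoid G Q) (fun a : Q × G => R.forceMinusAux a.1 a.2 r₁)
    (by rintro _ b ⟨g, rfl⟩; exact R.forceMinusAux_smul g b.1 b.2 r₁) v₀ : EB →ₗ[ℝ] ℝ)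

/-- The component `F̂_d⁺(v₀, r₁)` of the reduced discrete force. -/
def forcePlus (R : ReductionData EQ EG EB G Q) (v₀ : R.Tilde) (r₁ : Base G Q) :
    TangentSpace 𝓘(ℝ, EB) r₁ →ₗ[ℝ] ℝ :=
  (Quotient.lift (s := conjSetoid G Q) (fun a : Q × G => R.forcePlusAux a.1 a.2 r₁)
    (by rintro _ b ⟨g, rfl⟩; exact R.forcePlusAux_smul g b.1 b.2 r₁) v₀ : EB →ₗ[ℝ] ℝ)

/-! #### The second order spaces -/

/-- The second order reduced manifold `Q^{(2)}_G`: the fibred product over `Q/G` of two copies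
of `G̃ × Q/G`, with points `(v₀, r₁, v₁, r₂)`. -/
structure Second (R : ReductionData EQ EG EB G Q) where
  v₀ : R.Tilde
  r₁ : Base G Q
  v₁ : R.Tilde
  r₂ : Base G Q
  fibred : r₁ = TildeG.pr R.bundle v₁

/-- The space `Q̌^{(2)}_G`: the fibred product over `Q/G` of `Q × G × Q/G` and
`G̃ × Q/G`, with points `(q₀, w₀, r₁, v₁, r₂)`. -/
structure SecondCheck (R : ReductionData EQ EG EB G Q) where
  q₀ : Q
  w₀ : G
  r₁ : Base G Q
  v₁ : R.Tilde
  r₂ : Base G Q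
  fibred : r₁ = TildeG.pr R.bundle v₁

/-- The action of `G` on `Q̌^{(2)}_G`. -/
def SecondCheck.act {R : ReductionData EQ EG EB G Q} (g : G) (x : R.SecondCheck) :
    R.SecondCheck :=
  ⟨g • x.q₀, g * x.w₀ * g⁻¹, x.r₁, x.v₁, x.r₂, x.fibred⟩

/-- The quotient map `Q̌^{(2)}_G → Q^{(2)}_G`. -/
def SecondCheck.toSecond {R : ReductionData EQ EG EB G Q} (x : R.SecondCheck) : R.Second :=
  ⟨R.rho (x.q₀, x.w₀), x.r₁, x.v₁, x.r₂, x.fibred⟩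

theorem SecondCheck.toSecond_act {R : ReductionData EQ EG EB G Q} (g : G) (x : R.SecondCheck) :
    (x.act g).toSecond = x.toSecond := by
  simp only [toSecond, act, Second.mk.injEq, and_true]
  exact TildeG.rho_smul R.bundle g x.q₀ x.w₀

open Classical in
/-- The translation map: `τ(q, q') = g` if `g q' = q` (and `1` if there is no such `g`). -/
def tau (q q' : Q) : G := if h : ∃ g : G, g • q' = q then h.choose else 1

theorem tau_eq (R : ReductionData EQ EG EB G Q) (g : G) (q : Q) : tau (g • q) q = g := by
  have h : ∃ g' : G, g' • q = g • q := ⟨g, rfl⟩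
  rw [tau, dif_pos h]
  have h1 := h.choose_spec
  have h2 : (g⁻¹ * h.choose) • q = q := by rw [mul_smul, h1, inv_smul_smul]
  have := R.bundle.free _ _ h2
  rw [inv_mul_eq_one] at this
  exact this.symm

open Classical in
/-- The coordinate in `G` of `v = ρ(q', w')` with respect to a point `q` of the same fibre:
`τ(q, q') w' τ(q, q')⁻¹` (and `1` if `q` is not in the fibre of `v`). -/
def fibreCoord (R : ReductionData EQ EG EB G Q) (q : Q) (v : R.Tilde) : G :=
  Quotient.lift (s := conjSetoid G Q)
    (fun a : Q × G => if proj G q = proj G a.1 then tau q a.1 * a.2 * (tau q a.1)⁻¹ else 1)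
    (by
      rintro _ b ⟨g, rfl⟩
      by_cases h : proj G q = proj G b.1
      · obtain ⟨k, rfl⟩ := proj_eq_iff.1 h
        have h1 : k • b.1 = (k * g⁻¹) • g • b.1 := by rw [smul_smul, inv_mul_cancel_right]
        have h2 : (tau (k • b.1) (g • b.1) : G) = k * g⁻¹ := by rw [h1, R.tau_eq]
        simp only [proj_smul, if_true, h2, R.tau_eq]
        simp [mul_assoc]
      · simp [proj_smul, h]) v

theorem fibreCoord_smul (R : ReductionData EQ EG EB G Q) (g : G) (q : Q) (v : R.Tilde) :
    R.fibreCoord (g • q) v = g * R.fibreCoord q v * g⁻¹ := by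
  obtain ⟨a, rfl⟩ := (TildeG.isQuotientMap_rho R.bundle).surjective v
  simp only [fibreCoord, TildeG.rho, Quotient.lift_mk]
  rw [show proj G (g • q) = proj G q from proj_smul g q]
  by_cases h : proj G q = proj G a.1
  · obtain ⟨k, hk⟩ := proj_eq_iff.1 h
    subst hk
    simp only [proj_smul, if_true, smul_smul, R.tau_eq]
    simp [mul_assoc]
  · simp only [if_neg h]
    simp

namespace SecondCheck

variable {R : ReductionData EQ EG EB G Q}

/-- The map `F₁ : Q̌^{(2)}_G → Q`, the point `q₁`. -/
def q₁ (x : R.SecondCheck) : Q := R.F₁ x.q₀ x.w₀ x.r₁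

/-- The map `F₂ : Q̌^{(2)}_G → G`, the element `w₁` with `v₁ = ρ(q₁, w₁)`. -/
def w₁ (x : R.SecondCheck) : G := R.fibreCoord x.q₁ x.v₁

theorem q₁_act (g : G) (x : R.SecondCheck) : (x.act g).q₁ = g • x.q₁ := R.F₁_smul g _ _ _

theorem w₁_act (g : G) (x : R.SecondCheck) : (x.act g).w₁ = g * x.w₁ * g⁻¹ := by
  rw [w₁, q₁_act]
  exact R.fibreCoord_smul g _ _

/-- The morphism `φ̌ : p₃^* T(Q/G) → ℝ` over `Q̌^{(2)}_G`. -/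
def phi (x : R.SecondCheck) : TangentSpace 𝓘(ℝ, EB) x.r₁ →ₗ[ℝ] ℝ :=
  let a : EB →ₗ[ℝ] ℝ :=
    (R.D₁L x.q₁ x.w₁ x.r₂ : EQ →L[ℝ] ℝ).toLinearMap ∘ₗ (R.hLift x.q₁ : EB →ₗ[ℝ] EQ)
  let b : EB →ₗ[ℝ] ℝ := (R.D₃L x.q₀ x.w₀ x.r₁ : EB →L[ℝ] ℝ).toLinearMap
  let c : EB →ₗ[ℝ] ℝ := R.forceMinus x.v₁ x.r₂
  let d : EB →ₗ[ℝ] ℝ := R.forcePlus (R.rho (x.q₀, x.w₀)) x.r₁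
  a + b + c + d

theorem phi_act (g : G) (x : R.SecondCheck) : (x.act g).phi = x.phi := by
  have e1 : ((R.D₁L (x.act g).q₁ (x.act g).w₁ (x.act g).r₂ : EQ →L[ℝ] ℝ).toLinearMap ∘ₗ
      (R.hLift (x.act g).q₁ : EB →ₗ[ℝ] EQ)) =
      ((R.D₁L x.q₁ x.w₁ x.r₂ : EQ →L[ℝ] ℝ).toLinearMap ∘ₗ (R.hLift x.q₁ : EB →ₗ[ℝ] EQ)) := by
    rw [q₁_act, w₁_act]
    ext u
    refine Eq.trans ?_ (R.D₁L_smul g x.q₁ x.w₁ x.r₂ (R.hLift x.q₁ u))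
    exact congrArg (R.D₁L (g • x.q₁) (g * x.w₁ * g⁻¹) x.r₂ : EQ → ℝ) (R.hLift_smul g x.q₁ u)
  have e2 : R.D₃L (x.act g).q₀ (x.act g).w₀ (x.act g).r₁ = R.D₃L x.q₀ x.w₀ x.r₁ :=
    R.D₃L_smul g x.q₀ x.w₀ x.r₁
  have e3 : R.rho ((x.act g).q₀, (x.act g).w₀) = R.rho (x.q₀, x.w₀) :=
    TildeG.rho_smul R.bundle g x.q₀ x.w₀
  have e4 : ((R.D₃L (x.act g).q₀ (x.act g).w₀ (x.act g).r₁ : EB →L[ℝ] ℝ).toLinearMap) =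
      (R.D₃L x.q₀ x.w₀ x.r₁ : EB →L[ℝ] ℝ).toLinearMap := congrArg _ e2
  have e5 : (R.forcePlus (R.rho ((x.act g).q₀, (x.act g).w₀)) (x.act g).r₁ : EB →ₗ[ℝ] ℝ) =
      R.forcePlus (R.rho (x.q₀, x.w₀)) x.r₁ :=
    congrArg (fun v => (R.forcePlus v x.r₁ : EB →ₗ[ℝ] ℝ)) e3
  let c : EB →ₗ[ℝ] ℝ := R.forceMinus x.v₁ x.r₂
  exact congrArg₂ (fun y z : EB →ₗ[ℝ] ℝ => y + c + z)
    (congrArg₂ (fun y z : EB →ₗ[ℝ] ℝ => y + z) e1 e4) e5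

end SecondCheck

/-- The morphism `φ̄ : p₂^* T(Q/G) → ℝ` over `Q^{(2)}_G` induced by `φ̌`. -/
def phiBar (R : ReductionData EQ EG EB G Q) (x : R.Second) :
    TangentSpace 𝓘(ℝ, EB) x.r₁ →ₗ[ℝ] ℝ :=
  Quotient.lift (s := conjSetoid G Q)
    (fun a : Q × G => SecondCheck.phi (R := R) ⟨a.1, a.2, x.r₁, x.v₁, x.r₂, x.fibred⟩)
    (by
      rintro _ b ⟨g, rfl⟩
      exact SecondCheck.phi_act g
        (⟨b.1, b.2, x.r₁, x.v₁, x.r₂, x.fibred⟩ : R.SecondCheck)) x.v₀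

/-! #### The vertical equations -/

/-- The tangent vector `ξ w ∈ T_w G`, the image of `ξ ∈ 𝔤` under right translation by `w`. -/
def rightMul (ξ : TangentSpace 𝓘(ℝ, EG) (1 : G)) (w : G) : TangentSpace 𝓘(ℝ, EG) w :=
  (mfderiv 𝓘(ℝ, EG) 𝓘(ℝ, EG) (fun x : G => x * w) 1 ξ : EG)

/-- The adjoint action `ξ ↦ g ξ g⁻¹` on `𝔤`, the differential at `1` of the conjugation by `g`. -/
def adj (g : G) (ξ : TangentSpace 𝓘(ℝ, EG) (1 : G)) : TangentSpace 𝓘(ℝ, EG) (1 : G) :=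
  (mfderiv 𝓘(ℝ, EG) 𝓘(ℝ, EG) (fun x : G => g * x * g⁻¹) 1 ξ : EG)

theorem rightMul_adj (g w : G) (ξ : TangentSpace 𝓘(ℝ, EG) (1 : G)) :
    (rightMul (adj g ξ) (g * w * g⁻¹) : EG) =
      mfderiv 𝓘(ℝ, EG) 𝓘(ℝ, EG) (fun x : G => g * x * g⁻¹) w (rightMul ξ w) := by
  have hR : ∀ w : G, MDifferentiable 𝓘(ℝ, EG) 𝓘(ℝ, EG) (fun x : G => x * w) := fun w =>
    (contMDiff_id.mul contMDiff_const : ContMDiff 𝓘(ℝ, EG) 𝓘(ℝ, EG) ∞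
      (fun x : G => x * w)).mdifferentiable (by simp)
  have e1 := mfderiv_comp_apply_of_eq (x := (1 : G)) (hR (g * w * g⁻¹) 1)
    (mdiff_conj (EG := EG) g 1) (by simp) ξ
  have e2 := mfderiv_comp_apply_of_eq (x := (1 : G)) (mdiff_conj (EG := EG) g w)
    (hR w 1) (one_mul w) ξ
  have e3 : (fun x : G => x * (g * w * g⁻¹)) ∘ (fun x : G => g * x * g⁻¹) =
      (fun x : G => g * x * g⁻¹) ∘ fun x : G => x * w := by
    funext x
    simp [mul_assoc]
  rw [e3] at e1
  exact e1.symm.trans e2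

namespace SecondCheck

variable {R : ReductionData EQ EG EB G Q}

/-- The morphism `ψ̌ : Q̌^{(2)}_G × 𝔤 → ℝ` over `Q̌^{(2)}_G`,
`ψ̌(q₀, w₀, r₁, v₁, r₂, ξ₁) = D₂Ľ_d(q₀, w₀, r₁)(ξ₁ w₀) - D₂Ľ_d(q₁, w₁, r₂)(ξ₁ w₁)`. -/
def psi (x : R.SecondCheck) (ξ : TangentSpace 𝓘(ℝ, EG) (1 : G)) : ℝ :=
  R.D₂L x.q₀ x.w₀ x.r₁ (rightMul ξ x.w₀) - R.D₂L x.q₁ x.w₁ x.r₂ (rightMul ξ x.w₁)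

/-- `ψ̌` is linear on the fibres. -/
theorem psi_isLinearMap (x : R.SecondCheck) : IsLinearMap ℝ x.psi := by
  let f : G → EG →L[ℝ] EG := fun w => mfderiv 𝓘(ℝ, EG) 𝓘(ℝ, EG) (fun x : G => x * w) 1
  exact (((R.D₂L x.q₀ x.w₀ x.r₁ : EG →L[ℝ] ℝ).comp (f x.w₀)).toLinearMap -
    ((R.D₂L x.q₁ x.w₁ x.r₂ : EG →L[ℝ] ℝ).comp (f x.w₁)).toLinearMap).isLinear

theorem D₂L_rightMul_adj (g : G) (q : Q) (w : G) (r : Base G Q)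
    (ξ : TangentSpace 𝓘(ℝ, EG) (1 : G)) :
    R.D₂L (g • q) (g * w * g⁻¹) r (rightMul (adj g ξ) (g * w * g⁻¹)) =
      R.D₂L q w r (rightMul ξ w) := by
  exact (congrArg (R.D₂L (g • q) (g * w * g⁻¹) r : EG → ℝ) (rightMul_adj g w ξ)).trans
    (R.D₂L_smul g q w r (rightMul ξ w))

theorem psi_act (g : G) (x : R.SecondCheck) (ξ : TangentSpace 𝓘(ℝ, EG) (1 : G)) :
    (x.act g).psi (adj g ξ) = x.psi ξ := by
  unfold psi
  rw [q₁_act, w₁_act]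
  exact congrArg₂ (· - ·) (D₂L_rightMul_adj g x.q₀ x.w₀ x.r₁ ξ)
    (D₂L_rightMul_adj g x.q₁ x.w₁ x.r₂ ξ)

end SecondCheck

/-- The bundle `(Q̌^{(2)}_G × 𝔤)/G` over `Q^{(2)}_G`, for the action of `G` on `Q̌^{(2)}_G` and the
adjoint action on `𝔤`. -/
def VertBundle (R : ReductionData EQ EG EB G Q) : Type _ :=
  Quot fun a b : R.SecondCheck × TangentSpace 𝓘(ℝ, EG) (1 : G) =>
    ∃ g : G, b = (a.1.act g, adj g a.2)

/-- The class of `(q₀, w₀, r₁, v₁, r₂, ξ₁)`. -/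
def VertBundle.mk {R : ReductionData EQ EG EB G Q}
    (a : R.SecondCheck × TangentSpace 𝓘(ℝ, EG) (1 : G)) : R.VertBundle := Quot.mk _ a

/-- The bundle projection onto `Q^{(2)}_G`. -/
def VertBundle.base {R : ReductionData EQ EG EB G Q} : R.VertBundle → R.Second :=
  Quot.lift (fun a => a.1.toSecond)
    (by rintro a _ ⟨g, rfl⟩; exact (SecondCheck.toSecond_act g a.1).symm)

/-- The subbundle `(F₁^* 𝔤^𝒟)/G` of `(Q̌^{(2)}_G × 𝔤)/G`. -/
def VertBundle.constrained (R : ReductionData EQ EG EB G Q) : Set R.VertBundle :=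
  VertBundle.mk '' {a | a.2 ∈ R.gD a.1.q₁}

/-- The morphism `ψ̄ : (Q̌^{(2)}_G × 𝔤)/G → ℝ` over `Q^{(2)}_G` induced by `ψ̌`. -/
def psiBar (R : ReductionData EQ EG EB G Q) : R.VertBundle → ℝ :=
  Quot.lift (fun a => a.1.psi a.2)
    (by rintro a _ ⟨g, rfl⟩; exact (SecondCheck.psi_act g a.1 a.2).symm)

end ReductionData

end DiscreteReduction

end

open DiscreteReduction

noncomputable section

namespace DiscreteReduction

namespace ReductionData

variable {EQ EG EB G Q : Type*}
    [NormedAddCommGroup EQ] [NormedSpace ℝ EQ] [NormedAddCommGroup EG] [NormedSpace ℝ EG]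
    [NormedAddCommGroup EB] [NormedSpace ℝ EB]
    [TopologicalSpace G] [ChartedSpace EG G] [Group G] [LieGroup 𝓘(ℝ, EG) ∞ G]
    [TopologicalSpace Q] [ChartedSpace EQ Q] [IsManifold 𝓘(ℝ, EQ) ∞ Q] [MulAction G Q]
    [ChartedSpace EB (Base G Q)] [IsManifold 𝓘(ℝ, EB) ∞ (Base G Q)]

/-! #### Smoothness of the maps involved in the reduction -/

/-! Over the domain `W` of the discrete connection form, `Upsilon` sends $(q_0,q_1)$ to
$(\rho(q_0,\mathcal A_d(q_0,q_1)),\pi(q_1))$, and two pairs have the same image exactly when they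
differ by the diagonal action. There $L_d=\hat L_d\circ\Upsilon$ (`Lcheck_form`, differentiated in
`dLhat_dRho_dA`), and since $\mathcal D_d$ is $G$-invariant it can be recovered from its image
(`mem_DdHat_iff`). The kinematic constraints therefore match at once, and only the dynamical
conditions remain to be compared.

Conditions 1 and 2 are related by summation by parts and variations supported at one interior index.
Everything else rests on splitting $\mathcal D_q$ into horizontal lifts of $\hat{\mathcal
D}_{\pi(q)}$ and generators $\xi_Q(q)$ with $\xi\in\mathfrak g^{\mathcal D}_q$ (`hLift_mem_D`,
`exists_decomposition`). Applied to whole variations, the splitting turns condition 1 into condition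
3, because $d\Upsilon$ carries $h(\delta r)+\xi_Q$ to the prescribed $(\delta v,\delta r)$.

Applied to the equations of condition 2, it gives the two families of condition 4. On horizontal
lifts, the chain rule for $L_d=\check L_d(q_0,\mathcal A_d(q_0,q_1),\pi(q_1))$ produces the partial
derivatives of $\check L_d$, and the terms through $D_i\mathcal A_d$ are the reduced forces
(`D₁Ld_eq`, `D₂Ld_eq`). On vertical vectors, $\mathcal A_d(q_0,gq_1)=g\mathcal A_d(q_0,q_1)$ gives
$D_2\mathcal A_d(\xi_Q)=\xi w$, and the infinitesimal invariance of $L_d$ converts $D_1L_d(\xi_Q)$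
into minus the corresponding $D_2L_d$ term.

Condition 5 is condition 4 read on the quotient. The point $(q_{k-1},w_{k-1},r_k,v_k,r_{k+1})$
represents the point of $Q^{(2)}_G$, every other representative is a translate of it, and
$\check\phi$, $\check\psi$ and $\mathfrak g^{\mathcal D}$ are equivariant. -/

theorem F₁_form (R : ReductionData EQ EG EB G Q) (q₀ q₁ : Q)
    (h : (proj G q₀, proj G q₁) ∈ R.dom.W) :
    R.F₁ q₀ (R.form (q₀, q₁)) (proj G q₁) = q₁ := by
  have h1 := (R.existsUnique_dLift q₀ (proj G q₁) h).unique (R.dLift_spec q₀ _ h)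
    ⟨R.form_spec q₀ q₁ h, proj_smul _ _⟩
  rw [F₁, h1, smul_inv_smul]

/-- This is $\hat L_d\circ\Upsilon=L_d$ before passing to the quotient. Every formula below relating
derivatives of $L_d$ to derivatives of the reduced lagrangian is obtained by differentiating it. -/
theorem Lcheck_form (R : ReductionData EQ EG EB G Q) (q₀ q₁ : Q)
    (h : (proj G q₀, proj G q₁) ∈ R.dom.W) :
    R.Lcheck q₀ (R.form (q₀, q₁)) (proj G q₁) = R.sys.Ld (q₀, q₁) := by
  rw [Lcheck, R.F₁_form q₀ q₁ h]

/-- Left translation of $q_1$ is absorbed by the group element in the defining condition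
$(q_0,g^{-1}q_1)\in Hor\cap U$. The derivative of this identity at $1$ is the source of the right
translates $\xi w$ in the vertical equations. -/
theorem form_smul_right (R : ReductionData EQ EG EB G Q) (g : G) (q₀ q₁ : Q)
    (h : (proj G q₀, proj G q₁) ∈ R.dom.W) : R.form (q₀, g • q₁) = g * R.form (q₀, q₁) := by
  refine R.form_unique _ _ (by rwa [proj_smul]) _ ?_
  rw [mul_inv_rev, mul_smul, inv_smul_smul]
  exact R.form_spec q₀ q₁ h

theorem mdifferentiable_proj (R : ReductionData EQ EG EB G Q) :
    MDifferentiable 𝓘(ℝ, EQ) 𝓘(ℝ, EB) (proj G : Q → Base G Q) :=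
  R.bundle.smooth_proj.mdifferentiable (by simp)

theorem mdifferentiable_action (R : ReductionData EQ EG EB G Q) :
    MDifferentiable (𝓘(ℝ, EG).prod 𝓘(ℝ, EQ)) 𝓘(ℝ, EQ) (fun x : G × Q => x.1 • x.2) :=
  R.bundle.smooth_smul.mdifferentiable (by simp)

theorem mdifferentiable_orbit (R : ReductionData EQ EG EB G Q) (q : Q) :
    MDifferentiable 𝓘(ℝ, EG) 𝓘(ℝ, EQ) (fun g : G => g • q) :=
  R.mdifferentiable_action.comp (mdifferentiable_id.prodMk mdifferentiable_const)

theorem mdifferentiable_Ld (R : ReductionData EQ EG EB G Q) :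
    MDifferentiable (𝓘(ℝ, EQ).prod 𝓘(ℝ, EQ)) 𝓘(ℝ, ℝ) R.sys.Ld :=
  R.sys.smooth_Ld.mdifferentiable (by simp)

theorem isOpen_formDomain (R : ReductionData EQ EG EB G Q) :
    IsOpen {x : Q × Q | (proj G x.1, proj G x.2) ∈ R.dom.W} :=
  R.dom.isOpen_W.preimage
    ((R.bundle.smooth_proj.continuous.comp continuous_fst).prodMk
      (R.bundle.smooth_proj.continuous.comp continuous_snd))

/-- `W` is a union of open sets over each of which any function satisfying the defining condition is
smooth, so it suffices that `form` satisfies that condition on the member containing the point. -/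
theorem contMDiffAt_form (R : ReductionData EQ EG EB G Q) (q₀ q₁ : Q)
    (h : (proj G q₀, proj G q₁) ∈ R.dom.W) :
    ContMDiffAt (𝓘(ℝ, EQ).prod 𝓘(ℝ, EQ)) 𝓘(ℝ, EG) ∞ R.form (q₀, q₁) := by
  obtain ⟨O, hO, hq⟩ := h
  have hsub : O ⊆ R.dom.W := subset_sUnion_of_mem hO
  refine (hO.smooth R.form fun a b hab => R.form_spec a b (hsub hab)).contMDiffAt ?_
  exact (hO.isOpen.preimage
    ((R.bundle.smooth_proj.continuous.comp continuous_fst).prodMk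
      (R.bundle.smooth_proj.continuous.comp continuous_snd))).mem_nhds hq

theorem mdifferentiableAt_form (R : ReductionData EQ EG EB G Q) (q₀ q₁ : Q)
    (h : (proj G q₀, proj G q₁) ∈ R.dom.W) :
    MDifferentiableAt (𝓘(ℝ, EQ).prod 𝓘(ℝ, EQ)) 𝓘(ℝ, EG) R.form (q₀, q₁) :=
  (R.contMDiffAt_form q₀ q₁ h).mdifferentiableAt (by simp)

/-- With a local section $s$ of $\pi$ near $r_1$, uniqueness gives $\overline
h_d^{q_0}(r_1)=\mathcal A_d(q_0,s(r_1))^{-1}s(r_1)$, a composite of smooth maps. The smoothness of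
the discrete lift is thus inherited from that of the form; the submanifold structure of `Hor` plays
no role. -/
theorem contMDiffAt_dLift (R : ReductionData EQ EG EB G Q) (q₀ : Q) (r₁ : Base G Q)
    (h : (proj G q₀, r₁) ∈ R.dom.W) :
    ContMDiffAt (𝓘(ℝ, EQ).prod 𝓘(ℝ, EB)) 𝓘(ℝ, EQ) ∞
      (fun x : Q × Base G Q => R.dLift x.1 x.2) (q₀, r₁) := by
  obtain ⟨T, hT⟩ := TildeG.exists_localTriv R.bundle r₁
  have hs : ContMDiffAt (𝓘(ℝ, EQ).prod 𝓘(ℝ, EB)) 𝓘(ℝ, EQ) ∞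
      (fun x : Q × Base G Q => T.s x.2) (q₀, r₁) :=
    (T.smooth_s.contMDiffAt (T.isOpen.mem_nhds hT)).comp (q₀, r₁) contMDiffAt_snd
  have hf : ContMDiffAt (𝓘(ℝ, EQ).prod 𝓘(ℝ, EB)) 𝓘(ℝ, EG) ∞
      (fun x : Q × Base G Q => R.form (x.1, T.s x.2)) (q₀, r₁) :=
    (R.contMDiffAt_form q₀ (T.s r₁) (by rwa [T.proj_s r₁ hT])).comp (q₀, r₁)
      (contMDiffAt_fst.prodMk hs)
  refine ((R.bundle.smooth_smul _).comp (q₀, r₁) (hf.inv.prodMk hs)).congr_of_eventuallyEq ?_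
  have h1 : ∀ᶠ x : Q × Base G Q in 𝓝 (q₀, r₁), x.2 ∈ T.U :=
    continuousAt_snd.eventually (T.isOpen.mem_nhds hT)
  have h2 : ∀ᶠ x : Q × Base G Q in 𝓝 (q₀, r₁), (proj G x.1, x.2) ∈ R.dom.W :=
    (R.dom.isOpen_W.preimage ((R.bundle.smooth_proj.continuous.comp continuous_fst).prodMk
      continuous_snd)).mem_nhds h
  filter_upwards [h1, h2] with x hx1 hx2
  have hp : proj G (T.s x.2) = x.2 := T.proj_s _ hx1
  refine (R.existsUnique_dLift x.1 x.2 hx2).unique (R.dLift_spec _ _ hx2) ⟨?_, ?_⟩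
  · exact R.form_spec x.1 (T.s x.2) (by rwa [hp])
  · exact (proj_smul _ _).trans hp

theorem contMDiffAt_Lcheck (R : ReductionData EQ EG EB G Q) (q₀ : Q) (w₀ : G) (r₁ : Base G Q)
    (h : (proj G q₀, r₁) ∈ R.dom.W) :
    ContMDiffAt ((𝓘(ℝ, EQ).prod 𝓘(ℝ, EG)).prod 𝓘(ℝ, EB)) 𝓘(ℝ, ℝ) ∞
      (fun x : (Q × G) × Base G Q => R.Lcheck x.1.1 x.1.2 x.2) ((q₀, w₀), r₁) := by
  have hq : ContMDiffAt ((𝓘(ℝ, EQ).prod 𝓘(ℝ, EG)).prod 𝓘(ℝ, EB)) 𝓘(ℝ, EQ) ∞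
      (fun x : (Q × G) × Base G Q => x.1.1) ((q₀, w₀), r₁) :=
    contMDiffAt_fst.comp ((q₀, w₀), r₁) contMDiffAt_fst
  have hw : ContMDiffAt ((𝓘(ℝ, EQ).prod 𝓘(ℝ, EG)).prod 𝓘(ℝ, EB)) 𝓘(ℝ, EG) ∞
      (fun x : (Q × G) × Base G Q => x.1.2) ((q₀, w₀), r₁) :=
    contMDiffAt_snd.comp ((q₀, w₀), r₁) contMDiffAt_fst
  have hl : ContMDiffAt ((𝓘(ℝ, EQ).prod 𝓘(ℝ, EG)).prod 𝓘(ℝ, EB)) 𝓘(ℝ, EQ) ∞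
      (fun x : (Q × G) × Base G Q => R.dLift x.1.1 x.2) ((q₀, w₀), r₁) :=
    (R.contMDiffAt_dLift q₀ r₁ h).comp ((q₀, w₀), r₁) (hq.prodMk contMDiffAt_snd)
  have hF : ContMDiffAt ((𝓘(ℝ, EQ).prod 𝓘(ℝ, EG)).prod 𝓘(ℝ, EB)) 𝓘(ℝ, EQ) ∞
      (fun x : (Q × G) × Base G Q => R.F₁ x.1.1 x.1.2 x.2) ((q₀, w₀), r₁) :=
    (R.bundle.smooth_smul _).comp ((q₀, w₀), r₁) (hw.prodMk hl)
  exact (R.sys.smooth_Ld _).comp ((q₀, w₀), r₁) (hq.prodMk hF)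

theorem mdifferentiableAt_Lcheck (R : ReductionData EQ EG EB G Q) (q₀ : Q) (w₀ : G)
    (r₁ : Base G Q) (h : (proj G q₀, r₁) ∈ R.dom.W) :
    MDifferentiableAt ((𝓘(ℝ, EQ).prod 𝓘(ℝ, EG)).prod 𝓘(ℝ, EB)) 𝓘(ℝ, ℝ)
      (fun x : (Q × G) × Base G Q => R.Lcheck x.1.1 x.1.2 x.2) ((q₀, w₀), r₁) :=
  (R.contMDiffAt_Lcheck q₀ w₀ r₁ h).mdifferentiableAt (by simp)

/-- The local trivialisation of `G̃` used to define the chart at `v` is smooth at `v`. -/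
theorem contMDiffAt_conj (R : ReductionData EQ EG EB G Q) (v : R.Tilde) :
    ContMDiffAt (𝓘(ℝ, EB).prod 𝓘(ℝ, EG)) (𝓘(ℝ, EB).prod 𝓘(ℝ, EG)) ∞
      (TildeG.localTrivAt R.bundle (TildeG.pr R.bundle v)).conj v := by
  have : IsManifold 𝓘(ℝ, EG) ∞ G := ContMDiffMul.toIsManifold
  set T := TildeG.localTrivAt R.bundle (TildeG.pr R.bundle v)
  have hv : v ∈ T.conj.source := TildeG.mem_localTrivAt R.bundle (TildeG.pr R.bundle v)
  let e := chartAt (ModelProd EB EG) (T.conj v)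
  let c := chartAt (ModelProd EB EG) v
  have hc : ContMDiffAt (𝓘(ℝ, EB).prod 𝓘(ℝ, EG)) (𝓘(ℝ, EB).prod 𝓘(ℝ, EG)) ∞ c v :=
    (contMDiffOn_chart (x := v)).contMDiffAt (c.open_source.mem_nhds (mem_chart_source _ v))
  -- The chart at `v` is by definition the trivialisation followed by the chart `e`, so near `v` the
  -- trivialisation is `e.symm ∘ c`, a composite of chart maps.
  have hcv : c v = e (T.conj v) := rfl
  have he : ContMDiffAt (𝓘(ℝ, EB).prod 𝓘(ℝ, EG)) (𝓘(ℝ, EB).prod 𝓘(ℝ, EG)) ∞ e.symm (c v) :=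
    (contMDiffOn_chart_symm (x := T.conj v)).contMDiffAt
      (e.open_target.mem_nhds (by rw [hcv]; exact e.map_source (mem_chart_source _ _)))
  refine (he.comp v hc).congr_of_eventuallyEq ?_
  filter_upwards [c.open_source.mem_nhds (mem_chart_source _ v)] with x hx
  exact (e.left_inv (show T.conj x ∈ e.source from hx.2)).symm

/-- The inverse of a local trivialisation of $\tilde G$ is $(r,w)\mapsto\rho(s(r),w)$. It provides a
smooth local choice of representatives, in terms of which $\hat L_d$ becomes $\check
L_d(s(r),w,r_1)$. -/
theorem mdifferentiableAt_Lhat (R : ReductionData EQ EG EB G Q) (v : R.Tilde) (r₁ : Base G Q)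
    (h : (TildeG.pr R.bundle v, r₁) ∈ R.dom.W) :
    MDifferentiableAt ((𝓘(ℝ, EB).prod 𝓘(ℝ, EG)).prod 𝓘(ℝ, EB)) 𝓘(ℝ, ℝ) R.Lhat (v, r₁) := by
  have hconj := R.contMDiffAt_conj v
  set T := TildeG.localTrivAt R.bundle (TildeG.pr R.bundle v)
  have hv : v ∈ T.conj.source := TildeG.mem_localTrivAt R.bundle (TildeG.pr R.bundle v)
  have hU : TildeG.pr R.bundle v ∈ T.U := hv
  have h0 : ContMDiffAt ((𝓘(ℝ, EB).prod 𝓘(ℝ, EG)).prod 𝓘(ℝ, EB)) (𝓘(ℝ, EB).prod 𝓘(ℝ, EG)) ∞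
      (fun x : R.Tilde × Base G Q => T.conj x.1) (v, r₁) :=
    hconj.comp (v, r₁) contMDiffAt_fst
  have hs : ContMDiffAt ((𝓘(ℝ, EB).prod 𝓘(ℝ, EG)).prod 𝓘(ℝ, EB)) 𝓘(ℝ, EQ) ∞
      (fun x : R.Tilde × Base G Q => T.s (T.conj x.1).1) (v, r₁) :=
    (T.smooth_s.contMDiffAt (T.isOpen.mem_nhds hU)).comp (v, r₁)
      (contMDiffAt_fst.comp (v, r₁) h0)
  have hw : ContMDiffAt ((𝓘(ℝ, EB).prod 𝓘(ℝ, EG)).prod 𝓘(ℝ, EB)) 𝓘(ℝ, EG) ∞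
      (fun x : R.Tilde × Base G Q => (T.conj x.1).2) (v, r₁) :=
    contMDiffAt_snd.comp (v, r₁) h0
  have hp : proj G (T.s (TildeG.pr R.bundle v)) = TildeG.pr R.bundle v := T.proj_s _ hU
  have hL := (R.contMDiffAt_Lcheck (T.s (TildeG.pr R.bundle v)) (T.conj v).2 r₁
    (by rwa [hp])).comp (v, r₁) ((hs.prodMk hw).prodMk contMDiffAt_snd)
  refine (hL.congr_of_eventuallyEq ?_).mdifferentiableAt (by simp)
  filter_upwards [continuousAt_fst.eventually (T.conj.open_source.mem_nhds hv)] with x hx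
  have h1 : R.rho (T.s (T.conj x.1).1, (T.conj x.1).2) = x.1 := T.conj.left_inv hx
  change R.Lhat (x.1, x.2) = _
  rw [← h1]
  rfl

/-! #### Derivatives -/

theorem dLd_eq (R : ReductionData EQ EG EB G Q) (q₀ q₁ : Q) (a : TangentSpace 𝓘(ℝ, EQ) q₀)
    (b : TangentSpace 𝓘(ℝ, EQ) q₁) : R.dLd q₀ q₁ a b = R.D₁Ld q₀ q₁ a + R.D₂Ld q₀ q₁ b :=
  mfderiv_prod_eq_add_apply (R.mdifferentiable_Ld (q₀, q₁))

/-- The differential of `Ľ_d` in terms of its partial derivatives. -/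
theorem mfderiv_Lcheck_apply (R : ReductionData EQ EG EB G Q) (q₀ : Q) (w₀ : G) (r₁ : Base G Q)
    (h : (proj G q₀, r₁) ∈ R.dom.W) (a : TangentSpace 𝓘(ℝ, EQ) q₀)
    (b : TangentSpace 𝓘(ℝ, EG) w₀) (c : TangentSpace 𝓘(ℝ, EB) r₁) :
    mfderiv ((𝓘(ℝ, EQ).prod 𝓘(ℝ, EG)).prod 𝓘(ℝ, EB)) 𝓘(ℝ, ℝ)
      (fun x : (Q × G) × Base G Q => R.Lcheck x.1.1 x.1.2 x.2) ((q₀, w₀), r₁) ((a, b), c) =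
      R.D₁L q₀ w₀ r₁ a + R.D₂L q₀ w₀ r₁ b + R.D₃L q₀ w₀ r₁ c := by
  have hL := R.mdifferentiableAt_Lcheck q₀ w₀ r₁ h
  have hL' : MDifferentiableAt (𝓘(ℝ, EQ).prod 𝓘(ℝ, EG)) 𝓘(ℝ, ℝ)
      (fun x : Q × G => R.Lcheck x.1 x.2 r₁) (q₀, w₀) :=
    MDifferentiableAt.comp (f := fun x : Q × G => (x, r₁))
      (g := fun x : (Q × G) × Base G Q => R.Lcheck x.1.1 x.1.2 x.2) (q₀, w₀) hL
      (mdifferentiableAt_id.prodMk mdifferentiableAt_const)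
  refine (mfderiv_prod_eq_add_apply hL).trans ?_
  refine congrArg₂ (· + ·) ?_ rfl
  exact mfderiv_prod_eq_add_apply hL'

/-- The chain rule for `Ľ_d` along a smooth map into its domain. -/
theorem mfderiv_Lcheck_comp {E H M : Type*} [NormedAddCommGroup E] [NormedSpace ℝ E]
    [TopologicalSpace H] {I : ModelWithCorners ℝ E H} [TopologicalSpace M] [ChartedSpace H M]
    (R : ReductionData EQ EG EB G Q) {f₁ : M → Q} {f₂ : M → G} {f₃ : M → Base G Q} {x : M}
    (h₁ : MDifferentiableAt I 𝓘(ℝ, EQ) f₁ x) (h₂ : MDifferentiableAt I 𝓘(ℝ, EG) f₂ x)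
    (h₃ : MDifferentiableAt I 𝓘(ℝ, EB) f₃ x) (h : (proj G (f₁ x), f₃ x) ∈ R.dom.W)
    (u : TangentSpace I x) :
    mfderiv I 𝓘(ℝ, ℝ) (fun x => R.Lcheck (f₁ x) (f₂ x) (f₃ x)) x u =
      R.D₁L (f₁ x) (f₂ x) (f₃ x) (mfderiv I 𝓘(ℝ, EQ) f₁ x u) +
      R.D₂L (f₁ x) (f₂ x) (f₃ x) (mfderiv I 𝓘(ℝ, EG) f₂ x u) +
      R.D₃L (f₁ x) (f₂ x) (f₃ x) (mfderiv I 𝓘(ℝ, EB) f₃ x u) := by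
  have hL := R.mdifferentiableAt_Lcheck (f₁ x) (f₂ x) (f₃ x) h
  have e := mfderiv_comp_apply x hL ((h₁.prodMk h₂).prodMk h₃) u
  refine e.trans ?_
  rw [(h₁.prodMk h₂).mfderiv_prod h₃, h₁.mfderiv_prod h₂]
  exact R.mfderiv_Lcheck_apply _ _ _ h _ _ _

theorem mdifferentiableAt_form_left (R : ReductionData EQ EG EB G Q) (q₀ q₁ : Q)
    (h : (proj G q₀, proj G q₁) ∈ R.dom.W) :
    MDifferentiableAt 𝓘(ℝ, EQ) 𝓘(ℝ, EG) (fun x => R.form (x, q₁)) q₀ :=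
  (R.mdifferentiableAt_form q₀ q₁ h).comp q₀ (mdifferentiableAt_id.prodMk mdifferentiableAt_const)

theorem mdifferentiableAt_form_right (R : ReductionData EQ EG EB G Q) (q₀ q₁ : Q)
    (h : (proj G q₀, proj G q₁) ∈ R.dom.W) :
    MDifferentiableAt 𝓘(ℝ, EQ) 𝓘(ℝ, EG) (fun x => R.form (q₀, x)) q₁ :=
  (R.mdifferentiableAt_form q₀ q₁ h).comp q₁ (mdifferentiableAt_const.prodMk mdifferentiableAt_id)

/-- Chain rule for $x\mapsto\check L_d(x,\mathcal A_d(x,q_1),\pi(q_1))$. It agrees with $L_d(x,q_1)$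
only for $x$ near $q_0$, which is enough because the domain is open. The third slot is constant, so
no `D₃L` term arises. -/
theorem D₁Ld_eq (R : ReductionData EQ EG EB G Q) (q₀ q₁ : Q)
    (h : (proj G q₀, proj G q₁) ∈ R.dom.W) (u : TangentSpace 𝓘(ℝ, EQ) q₀) :
    R.D₁Ld q₀ q₁ u = R.D₁L q₀ (R.form (q₀, q₁)) (proj G q₁) u +
      R.D₂L q₀ (R.form (q₀, q₁)) (proj G q₁) (R.D₁A q₀ q₁ u) := by
  have e : mfderiv 𝓘(ℝ, EQ) 𝓘(ℝ, ℝ) (fun x => R.Lcheck x (R.form (x, q₁)) (proj G q₁)) q₀ =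
      mfderiv 𝓘(ℝ, EQ) 𝓘(ℝ, ℝ) (fun x => R.sys.Ld (x, q₁)) q₀ := by
    apply Filter.EventuallyEq.mfderiv_eq
    filter_upwards [(continuous_id.prodMk continuous_const).continuousAt.preimage_mem_nhds
      (R.isOpen_formDomain.mem_nhds (show (q₀, q₁) ∈ _ from h))] with x hx
    exact R.Lcheck_form x q₁ hx
  have e1 := R.mfderiv_Lcheck_comp (mdifferentiableAt_id (x := q₀) (I := 𝓘(ℝ, EQ)))
    (R.mdifferentiableAt_form_left q₀ q₁ h)
    (mdifferentiableAt_const (I' := 𝓘(ℝ, EB)) (c := proj G q₁)) h u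
  rw [mfderiv_const, mfderiv_id] at e1
  refine (DFunLike.congr_fun e u).symm.trans (e1.trans ?_)
  exact (congrArg₂ (· + ·) rfl (map_zero _)).trans (add_zero _)

/-- Chain rule for $x\mapsto\check L_d(q_0,\mathcal A_d(q_0,x),\pi(x))$; now the first slot is the
constant one, and the third contributes through $d\pi$. -/
theorem D₂Ld_eq (R : ReductionData EQ EG EB G Q) (q₀ q₁ : Q)
    (h : (proj G q₀, proj G q₁) ∈ R.dom.W) (u : TangentSpace 𝓘(ℝ, EQ) q₁) :
    R.D₂Ld q₀ q₁ u = R.D₂L q₀ (R.form (q₀, q₁)) (proj G q₁) (R.D₂A q₀ q₁ u) +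
      R.D₃L q₀ (R.form (q₀, q₁)) (proj G q₁) (R.dproj q₁ u) := by
  have e : mfderiv 𝓘(ℝ, EQ) 𝓘(ℝ, ℝ) (fun x => R.Lcheck q₀ (R.form (q₀, x)) (proj G x)) q₁ =
      mfderiv 𝓘(ℝ, EQ) 𝓘(ℝ, ℝ) (fun x => R.sys.Ld (q₀, x)) q₁ := by
    apply Filter.EventuallyEq.mfderiv_eq
    filter_upwards [(continuous_const.prodMk continuous_id).continuousAt.preimage_mem_nhds
      (R.isOpen_formDomain.mem_nhds (show (q₀, q₁) ∈ _ from h))] with x hx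
    exact R.Lcheck_form q₀ x hx
  have e1 := R.mfderiv_Lcheck_comp
    (mdifferentiableAt_const (I := 𝓘(ℝ, EQ)) (I' := 𝓘(ℝ, EQ)) (c := q₀))
    (R.mdifferentiableAt_form_right q₀ q₁ h) (R.mdifferentiable_proj q₁) h u
  rw [mfderiv_const] at e1
  refine (DFunLike.congr_fun e u).symm.trans (e1.trans ?_)
  refine congrArg₂ (· + ·) ?_ rfl
  exact (congrArg₂ (· + ·) (map_zero _) rfl).trans (zero_add _)

/-- `L_d` is the pullback of `L̂_d` by `Υ`, on the level of differentials. -/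
theorem dLhat_dRho_dA (R : ReductionData EQ EG EB G Q) (q₀ q₁ : Q)
    (h : (proj G q₀, proj G q₁) ∈ R.dom.W) (a : TangentSpace 𝓘(ℝ, EQ) q₀)
    (b : TangentSpace 𝓘(ℝ, EQ) q₁) :
    R.dLhat (R.rho (q₀, R.form (q₀, q₁))) (proj G q₁)
      (R.dRho q₀ (R.form (q₀, q₁)) a (R.dA q₀ q₁ a b)) (R.dproj q₁ b) = R.dLd q₀ q₁ a b := by
  have hA := R.mdifferentiableAt_form q₀ q₁ h
  have hf : MDifferentiableAt (𝓘(ℝ, EQ).prod 𝓘(ℝ, EQ)) (𝓘(ℝ, EQ).prod 𝓘(ℝ, EG))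
      (fun x : Q × Q => (x.1, R.form x)) (q₀, q₁) := mdifferentiableAt_fst.prodMk hA
  have hρ : MDifferentiableAt (𝓘(ℝ, EQ).prod 𝓘(ℝ, EG)) (𝓘(ℝ, EB).prod 𝓘(ℝ, EG)) R.rho
      (q₀, R.form (q₀, q₁)) := (TildeG.contMDiff_rho _).mdifferentiableAt (by simp)
  have hρf : MDifferentiableAt (𝓘(ℝ, EQ).prod 𝓘(ℝ, EQ)) (𝓘(ℝ, EB).prod 𝓘(ℝ, EG))
      (fun x : Q × Q => R.rho (x.1, R.form x)) (q₀, q₁) := hρ.comp (q₀, q₁) hf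
  have hπ : MDifferentiableAt (𝓘(ℝ, EQ).prod 𝓘(ℝ, EQ)) 𝓘(ℝ, EB)
      (fun x : Q × Q => proj G x.2) (q₀, q₁) :=
    (R.mdifferentiable_proj q₁).comp (q₀, q₁) mdifferentiableAt_snd
  have hL := R.mdifferentiableAt_Lhat (R.rho (q₀, R.form (q₀, q₁))) (proj G q₁) h
  have e : mfderiv (𝓘(ℝ, EQ).prod 𝓘(ℝ, EQ)) 𝓘(ℝ, ℝ)
      (R.Lhat ∘ fun x : Q × Q => (R.rho (x.1, R.form x), proj G x.2)) (q₀, q₁) =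
      mfderiv (𝓘(ℝ, EQ).prod 𝓘(ℝ, EQ)) 𝓘(ℝ, ℝ) R.sys.Ld (q₀, q₁) := by
    apply Filter.EventuallyEq.mfderiv_eq
    filter_upwards [R.isOpen_formDomain.mem_nhds (show (q₀, q₁) ∈ _ from h)] with x hx
    exact R.Lcheck_form x.1 x.2 hx
  -- The pair is named so that it is read as a single tangent vector of $Q\times Q$, as the chain
  -- rule requires.
  let ab : TangentSpace (𝓘(ℝ, EQ).prod 𝓘(ℝ, EQ)) (q₀, q₁) := (a, b)
  have e1 := mfderiv_comp_apply (q₀, q₁) hL (hρf.prodMk hπ) ab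
  have e2 : (mfderiv (𝓘(ℝ, EQ).prod 𝓘(ℝ, EQ)) (𝓘(ℝ, EB).prod 𝓘(ℝ, EG))
      (fun x : Q × Q => R.rho (x.1, R.form x)) (q₀, q₁) ab : EB × EG) =
      R.dRho q₀ (R.form (q₀, q₁)) a (R.dA q₀ q₁ a b) := by
    refine (mfderiv_comp_apply (q₀, q₁) hρ hf ab).trans ?_
    rw [mdifferentiableAt_fst.mfderiv_prod hA, mfderiv_fst]
    rfl
  have e3 : (mfderiv (𝓘(ℝ, EQ).prod 𝓘(ℝ, EQ)) 𝓘(ℝ, EB)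
      (fun x : Q × Q => proj G x.2) (q₀, q₁) ab : EB) = R.dproj q₁ b := by
    refine (mfderiv_comp_apply (q₀, q₁) (R.mdifferentiable_proj q₁)
      mdifferentiableAt_snd ab).trans ?_
    rw [mfderiv_snd]
    rfl
  rw [hρf.mfderiv_prod hπ] at e1
  refine Eq.trans ?_ (e1.symm.trans (DFunLike.congr_fun e ab))
  exact congrArg₂ (fun (y : EB × EG) (z : EB) => (mfderiv ((𝓘(ℝ, EB).prod 𝓘(ℝ, EG)).prod 𝓘(ℝ, EB))
    𝓘(ℝ, ℝ) R.Lhat (R.rho (q₀, R.form (q₀, q₁)), proj G q₁) ((y, z) : (EB × EG) × EB) : ℝ))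
    e2.symm e3.symm

/-! #### Vertical variations -/

theorem dproj_infGen (R : ReductionData EQ EG EB G Q) (q : Q)
    (ξ : TangentSpace 𝓘(ℝ, EG) (1 : G)) : R.dproj q (infGen EQ EG G q ξ) = 0 := by
  have h : infGen EQ EG G q ξ ∈ vertical EQ EG G q := ⟨ξ, rfl⟩
  rw [← R.ker_dproj q] at h
  exact h

/-- Obtained by differentiating $(gxg^{-1})\cdot gq=g\cdot xq$ in $x$ at $1$. -/
theorem infGen_smul (R : ReductionData EQ EG EB G Q) (g : G) (q : Q)
    (ξ : TangentSpace 𝓘(ℝ, EG) (1 : G)) :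
    (infGen EQ EG G (g • q) (adj g ξ) : EQ) = dAct g q (infGen EQ EG G q ξ) := by
  have e1 := mfderiv_comp_apply_of_eq (x := (1 : G)) (R.mdifferentiable_orbit (g • q) 1)
    (mdiff_conj (EG := EG) g 1) (by simp) ξ
  have e2 := mfderiv_comp_apply_of_eq (x := (1 : G)) (R.mdiff_smul g q)
    (R.mdifferentiable_orbit q 1) (one_smul G q) ξ
  have e3 : (fun x : G => x • g • q) ∘ (fun x : G => g * x * g⁻¹) =
      (fun x : Q => g • x) ∘ fun x : G => x • q := by
    funext x
    simp [mul_smul]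
  rw [e3] at e1
  exact e1.symm.trans e2

/-- Derivative at $g=1$ of $\mathcal A_d(q_0,gq_1)=g\,\mathcal A_d(q_0,q_1)$, the orbit map through
$q_1$ having velocity $\xi_Q(q_1)$. -/
theorem D₂A_infGen (R : ReductionData EQ EG EB G Q) (q₀ q₁ : Q)
    (h : (proj G q₀, proj G q₁) ∈ R.dom.W) (ξ : TangentSpace 𝓘(ℝ, EG) (1 : G)) :
    R.D₂A q₀ q₁ (infGen EQ EG G q₁ ξ) = rightMul ξ (R.form (q₀, q₁)) := by
  have e1 := mfderiv_comp_apply_of_eq (x := (1 : G)) (R.mdifferentiableAt_form_right q₀ q₁ h)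
    (R.mdifferentiable_orbit q₁ 1) (one_smul G q₁) ξ
  have e2 : (fun x => R.form (q₀, x)) ∘ (fun g : G => g • q₁) =
      fun g => g * R.form (q₀, q₁) := funext fun g => R.form_smul_right g q₀ q₁ h
  rw [e2] at e1
  exact e1.symm

theorem D₂Ld_infGen (R : ReductionData EQ EG EB G Q) (q₀ q₁ : Q)
    (h : (proj G q₀, proj G q₁) ∈ R.dom.W) (ξ : TangentSpace 𝓘(ℝ, EG) (1 : G)) :
    R.D₂Ld q₀ q₁ (infGen EQ EG G q₁ ξ) =
      R.D₂L q₀ (R.form (q₀, q₁)) (proj G q₁) (rightMul ξ (R.form (q₀, q₁))) := by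
  rw [R.D₂Ld_eq q₀ q₁ h, R.D₂A_infGen q₀ q₁ h, R.dproj_infGen, map_zero, add_zero]

/-- Infinitesimal invariance of `L_d`. -/
theorem dLd_infGen (R : ReductionData EQ EG EB G Q) (q₀ q₁ : Q)
    (ξ : TangentSpace 𝓘(ℝ, EG) (1 : G)) :
    R.dLd q₀ q₁ (infGen EQ EG G q₀ ξ) (infGen EQ EG G q₁ ξ) = 0 := by
  have h0 := R.mdifferentiable_orbit q₀ 1
  have h1 := R.mdifferentiable_orbit q₁ 1
  have e1 := mfderiv_comp_apply_of_eq (x := (1 : G)) (R.mdifferentiable_Ld (q₀, q₁))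
    (h0.prodMk h1) (by simp) ξ
  have e2 : R.sys.Ld ∘ (fun g : G => (g • q₀, g • q₁)) = fun _ => R.sys.Ld (q₀, q₁) :=
    funext fun g => R.symm.Ld_smul g q₀ q₁
  rw [e2, mfderiv_const, h0.mfderiv_prod h1] at e1
  exact e1.symm

/-- Infinitesimal invariance trades the first slot for minus the second, where `D₂Ld_infGen`
applies. This gives the minus sign of the vertical equation without computing $D_1\mathcal A_d$ on
vertical vectors. -/
theorem D₁Ld_infGen (R : ReductionData EQ EG EB G Q) (q₀ q₁ : Q)
    (h : (proj G q₀, proj G q₁) ∈ R.dom.W) (ξ : TangentSpace 𝓘(ℝ, EG) (1 : G)) :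
    R.D₁Ld q₀ q₁ (infGen EQ EG G q₀ ξ) =
      -R.D₂L q₀ (R.form (q₀, q₁)) (proj G q₁) (rightMul ξ (R.form (q₀, q₁))) := by
  have e := R.dLd_infGen q₀ q₁ ξ
  rw [R.dLd_eq, R.D₂Ld_infGen q₀ q₁ h] at e
  exact eq_neg_of_add_eq_zero_left e

/-! #### Constraints -/

theorem mem_Dhat_proj (R : ReductionData EQ EG EB G Q) (q : Q)
    (u : TangentSpace 𝓘(ℝ, EB) (proj G q)) :
    u ∈ R.Dhat (proj G q) ↔ ∃ v ∈ R.sys.D q, R.dproj q v = u := Iff.rfl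

/-- In $\mathcal D=\mathcal S\oplus\mathcal H$ the summand $\mathcal S$ is vertical and is killed by
$d\pi$, while $\mathcal H$ lies in the horizontal space. The lift of the projection of a constrained
vector is therefore its $\mathcal H$-component. -/
theorem hLift_mem_D (R : ReductionData EQ EG EB G Q) (q : Q)
    (u : TangentSpace 𝓘(ℝ, EB) (proj G q)) (hu : u ∈ R.Dhat (proj G q)) :
    R.hLift q u ∈ R.sys.D q := by
  obtain ⟨v, hv, rfl⟩ := (R.mem_Dhat_proj q u).1 hu
  rw [← R.split.S_sup_H q] at hv
  obtain ⟨s, hs, y, hy, rfl⟩ := Submodule.mem_sup.1 hv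
  have hs0 : R.dproj q s = 0 := by
    have := hs.1
    rw [← R.ker_dproj q] at this
    exact this
  rw [map_add, hs0, zero_add, R.hLift_unique q y (Submodule.mem_sup_right hy),
    ← R.split.S_sup_H q]
  exact Submodule.mem_sup_right hy

/-- A vector is the sum of the horizontal lift of its projection and a vertical vector. -/
theorem exists_hLift_add_infGen (R : ReductionData EQ EG EB G Q) (q : Q)
    (v : TangentSpace 𝓘(ℝ, EQ) q) :
    ∃ ξ : TangentSpace 𝓘(ℝ, EG) (1 : G), v = R.hLift q (R.dproj q v) + infGen EQ EG G q ξ := by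
  have h : v - R.hLift q (R.dproj q v) ∈ vertical EQ EG G q := by
    rw [← R.ker_dproj q]
    change R.dproj q (v - R.hLift q (R.dproj q v)) = 0
    rw [map_sub, R.dproj_hLift, sub_self]
  obtain ⟨ξ, hξ⟩ := h
  refine ⟨ξ, ?_⟩
  change infGen EQ EG G q ξ = _ at hξ
  rw [hξ, add_sub_cancel]

/-- The decomposition of constrained vectors into a horizontal and a vertical part; the vertical
part of the zero vector can be taken to be zero. -/
theorem exists_decomposition (R : ReductionData EQ EG EB G Q) (q : Q)
    (v : TangentSpace 𝓘(ℝ, EQ) q) :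
    ∃ ξ : TangentSpace 𝓘(ℝ, EG) (1 : G), v = R.hLift q (R.dproj q v) + infGen EQ EG G q ξ ∧
      (v ∈ R.sys.D q → ξ ∈ R.gD q) ∧ (v = 0 → ξ = 0) := by
  -- The generator is obtained by mere existence, so for the zero vector it is fixed to be $0$ by
  -- hand. This secures $\xi_0=\xi_N=0$ for variations vanishing at the ends, without appealing to
  -- injectivity of $\xi\mapsto\xi_Q(q)$.
  by_cases h0 : v = 0
  · subst h0
    exact ⟨0, by simp, fun _ => zero_mem _, fun _ => rfl⟩
  obtain ⟨ξ, hξ⟩ := R.exists_hLift_add_infGen q v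
  refine ⟨ξ, hξ, fun hv => ?_, fun h => absurd h h0⟩
  have h1 : infGen EQ EG G q ξ = v - R.hLift q (R.dproj q v) := by
    rw [eq_sub_iff_add_eq', ← hξ]
  change infGen EQ EG G q ξ ∈ R.sys.D q
  rw [h1]
  exact sub_mem hv (R.hLift_mem_D q _ ⟨v, hv, rfl⟩)

/-- Invariance of $\mathcal D$ read through the equivariance of infinitesimal generators; it allows
$\mathfrak g^{\mathcal D}$ to be compared at different representatives of a point of $Q^{(2)}_G$. -/
theorem adj_mem_gD (R : ReductionData EQ EG EB G Q) (g : G) (q : Q)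
    (ξ : TangentSpace 𝓘(ℝ, EG) (1 : G)) (hξ : ξ ∈ R.gD q) : adj g ξ ∈ R.gD (g • q) := by
  have h := R.symm.D_smul g q _ (show infGen EQ EG G q ξ ∈ R.sys.D q from hξ)
  change infGen EQ EG G (g • q) (adj g ξ) ∈ R.sys.D (g • q)
  have e : infGen EQ EG G (g • q) (adj g ξ) = dAct g q (infGen EQ EG G q ξ) :=
    R.infGen_smul g q ξ
  rwa [e]

/-- Over the domain the fibres of `Upsilon` are diagonal $G$-orbits, and $\mathcal D_d$ is a union
of such orbits. Hence a point of the image of $\mathcal D_d$ has all its preimages over the domain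
in $\mathcal D_d$. -/
theorem mem_DdHat_iff (R : ReductionData EQ EG EB G Q) (q₀ q₁ : Q)
    (h : (proj G q₀, proj G q₁) ∈ R.dom.W) :
    (R.rho (q₀, R.form (q₀, q₁)), proj G q₁) ∈ R.DdHat ↔ (q₀, q₁) ∈ R.sys.Dd := by
  refine ⟨?_, fun hd => ⟨(q₀, q₁), ⟨hd, h⟩, rfl⟩⟩
  rintro ⟨⟨x, y⟩, ⟨hd, hxy⟩, he⟩
  obtain ⟨he1, he2⟩ := Prod.mk.inj he
  obtain ⟨g, hg⟩ := (TildeG.rho_eq_iff R.bundle).1 he1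
  obtain ⟨rfl, hg2⟩ := Prod.mk.inj hg
  obtain ⟨k, rfl⟩ := proj_eq_iff.1 he2
  -- A priori the two points are moved by different elements $g$ and $k$. Factoring $k=g(g^{-1}k)$
  -- gives the form at $(gq_0,kq_1)$ as $g(g^{-1}k)\mathcal A_d(q_0,q_1)g^{-1}$; comparison with
  -- $g\mathcal A_d(q_0,q_1)g^{-1}$ forces $k=g$.
  have hk : k • q₁ = g • (g⁻¹ * k) • q₁ := by rw [smul_smul, mul_inv_cancel_left]
  change g * R.form (q₀, q₁) * g⁻¹ = R.form (g • q₀, k • q₁) at hg2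
  rw [hk, R.form_smul, R.form_smul_right _ _ _ h] at hg2
  have hgk : g⁻¹ * k = 1 := by simpa using hg2
  have : k = g := (inv_mul_eq_one.1 hgk).symm
  subst this
  simpa using R.symm.Dd_smul k⁻¹ _ _ hd

/-! #### The Lagrange-D'Alembert equations and their reduction -/

theorem forcePlus_rho (R : ReductionData EQ EG EB G Q) (q₀ q₁ : Q)
    (h : (proj G q₀, proj G q₁) ∈ R.dom.W) (u : TangentSpace 𝓘(ℝ, EB) (proj G q₁)) :
    R.forcePlus (R.rho (q₀, R.form (q₀, q₁))) (proj G q₁) u =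
      R.D₂L q₀ (R.form (q₀, q₁)) (proj G q₁) (R.D₂A q₀ q₁ (R.hLift q₁ u)) := by
  -- The force is defined at $\tilde F_1(q_0,w_0,r_1)$, which equals $q_1$ only propositionally. As
  -- the tangent spaces depend on the point, the substitution is made for a variable point `q`.
  have e : ∀ q : Q, q = q₁ → (R.D₂A q₀ q (R.hLift q u) : EG) = R.D₂A q₀ q₁ (R.hLift q₁ u) := by
    rintro _ rfl
    rfl
  change R.forcePlusAux q₀ (R.form (q₀, q₁)) (proj G q₁) u = _
  rw [forcePlusAux, if_pos h]
  exact congrArg (R.D₂L q₀ (R.form (q₀, q₁)) (proj G q₁) : EG → ℝ) (e _ (R.F₁_form q₀ q₁ h))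

theorem forceMinus_rho (R : ReductionData EQ EG EB G Q) (q₀ q₁ : Q)
    (h : (proj G q₀, proj G q₁) ∈ R.dom.W) (u : TangentSpace 𝓘(ℝ, EB) (proj G q₀)) :
    R.forceMinus (R.rho (q₀, R.form (q₀, q₁))) (proj G q₁) u =
      R.D₂L q₀ (R.form (q₀, q₁)) (proj G q₁) (R.D₁A q₀ q₁ (R.hLift q₀ u)) := by
  have e : ∀ q : Q, q = q₁ → (R.D₁A q₀ q (R.hLift q₀ u) : EG) = R.D₁A q₀ q₁ (R.hLift q₀ u) := by
    rintro _ rfl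
    rfl
  change R.forceMinusAux q₀ (R.form (q₀, q₁)) (proj G q₁) u = _
  rw [forceMinusAux, if_pos h]
  exact congrArg (R.D₂L q₀ (R.form (q₀, q₁)) (proj G q₁) : EG → ℝ) (e _ (R.F₁_form q₀ q₁ h))

/-- The Lagrange-D'Alembert form on horizontal lifts. -/
theorem D₁Ld_add_D₂Ld_hLift (R : ReductionData EQ EG EB G Q) (q₀ q₁ q₂ : Q)
    (h : (proj G q₀, proj G q₁) ∈ R.dom.W) (h' : (proj G q₁, proj G q₂) ∈ R.dom.W)
    (u : TangentSpace 𝓘(ℝ, EB) (proj G q₁)) :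
    R.D₁Ld q₁ q₂ (R.hLift q₁ u) + R.D₂Ld q₀ q₁ (R.hLift q₁ u) =
      R.D₁L q₁ (R.form (q₁, q₂)) (proj G q₂) (R.hLift q₁ u) +
      R.D₃L q₀ (R.form (q₀, q₁)) (proj G q₁) u +
      R.forceMinus (R.rho (q₁, R.form (q₁, q₂))) (proj G q₂) u +
      R.forcePlus (R.rho (q₀, R.form (q₀, q₁))) (proj G q₁) u := by
  rw [R.D₁Ld_eq q₁ q₂ h', R.D₂Ld_eq q₀ q₁ h, R.dproj_hLift]
  have e1 := R.forceMinus_rho q₁ q₂ h' u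
  have e2 := R.forcePlus_rho q₀ q₁ h u
  linarith

/-- The Lagrange-D'Alembert form on vertical vectors. -/
theorem D₁Ld_add_D₂Ld_infGen (R : ReductionData EQ EG EB G Q) (q₀ q₁ q₂ : Q)
    (h : (proj G q₀, proj G q₁) ∈ R.dom.W) (h' : (proj G q₁, proj G q₂) ∈ R.dom.W)
    (ξ : TangentSpace 𝓘(ℝ, EG) (1 : G)) :
    R.D₁Ld q₁ q₂ (infGen EQ EG G q₁ ξ) + R.D₂Ld q₀ q₁ (infGen EQ EG G q₁ ξ) =
      R.D₂L q₀ (R.form (q₀, q₁)) (proj G q₁) (rightMul ξ (R.form (q₀, q₁))) -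
      R.D₂L q₁ (R.form (q₁, q₂)) (proj G q₂) (rightMul ξ (R.form (q₁, q₂))) := by
  rw [R.D₁Ld_infGen q₁ q₂ h', R.D₂Ld_infGen q₀ q₁ h]
  ring

/-- A linear form vanishes on `𝒟_q` if and only if it vanishes on the horizontal lifts of
`𝒟̂_{π q}` and on the infinitesimal generators of `𝔤^𝒟_q`. -/
theorem forall_mem_D_iff (R : ReductionData EQ EG EB G Q) (q : Q)
    (f : TangentSpace 𝓘(ℝ, EQ) q →ₗ[ℝ] ℝ) :
    (∀ u ∈ R.sys.D q, f u = 0) ↔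
      (∀ u ∈ R.Dhat (proj G q), f (R.hLift q u) = 0) ∧
      ∀ ξ ∈ R.gD q, f (infGen EQ EG G q ξ) = 0 := by
  refine ⟨fun h => ⟨fun u hu => h _ (R.hLift_mem_D q u hu), fun ξ hξ => h _ hξ⟩, ?_⟩
  rintro ⟨h1, h2⟩ u hu
  obtain ⟨ξ, hξ, hξD, -⟩ := R.exists_decomposition q u
  rw [hξ, map_add, h1 (R.dproj q u) ⟨u, hu, rfl⟩, h2 _ (hξD hu), add_zero]

/-- The form $D_1L_d+D_2L_d$ is tested separately on the two families that span $\mathcal D_{q_1}$,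
and its value on each was computed above. This is the equivalence of conditions 2 and 4 at one
interior index. -/
theorem lagrangeDAlembert_iff (R : ReductionData EQ EG EB G Q) (q₀ q₁ q₂ : Q)
    (h : (proj G q₀, proj G q₁) ∈ R.dom.W) (h' : (proj G q₁, proj G q₂) ∈ R.dom.W) :
    (∀ u ∈ R.sys.D q₁, R.D₁Ld q₁ q₂ u + R.D₂Ld q₀ q₁ u = 0) ↔
      (∀ u ∈ R.Dhat (proj G q₁),
        R.D₁L q₁ (R.form (q₁, q₂)) (proj G q₂) (R.hLift q₁ u) +
        R.D₃L q₀ (R.form (q₀, q₁)) (proj G q₁) u +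
        R.forceMinus (R.rho (q₁, R.form (q₁, q₂))) (proj G q₂) u +
        R.forcePlus (R.rho (q₀, R.form (q₀, q₁))) (proj G q₁) u = 0) ∧
      ∀ ξ ∈ R.gD q₁,
        R.D₂L q₀ (R.form (q₀, q₁)) (proj G q₁) (rightMul ξ (R.form (q₀, q₁))) -
        R.D₂L q₁ (R.form (q₁, q₂)) (proj G q₂) (rightMul ξ (R.form (q₁, q₂))) = 0 := by
  refine (R.forall_mem_D_iff q₁
    ((R.D₁Ld q₁ q₂).toLinearMap + (R.D₂Ld q₀ q₁).toLinearMap)).trans (and_congr ?_ ?_)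
  · refine forall₂_congr fun u _ => ?_
    rw [← R.D₁Ld_add_D₂Ld_hLift q₀ q₁ q₂ h h' u]
    rfl
  · refine forall₂_congr fun ξ _ => ?_
    rw [← R.D₁Ld_add_D₂Ld_infGen q₀ q₁ q₂ h h' ξ]
    rfl

/-! #### The intrinsic equations -/

/-- By freeness the translation element from `q` to itself is $1$, so the representative based at
`q` is read off unchanged. -/
theorem fibreCoord_rho (R : ReductionData EQ EG EB G Q) (q : Q) (w : G) :
    R.fibreCoord q (R.rho (q, w)) = w := by
  have h : (tau q q : G) = 1 := by simpa using R.tau_eq 1 q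
  exact (if_pos rfl).trans (by simp [h])

/-- The point of `Q̌^{(2)}_G` determined by three points of `Q`. -/
def secondCheckOf (R : ReductionData EQ EG EB G Q) (q₀ q₁ q₂ : Q) : R.SecondCheck :=
  ⟨q₀, R.form (q₀, q₁), proj G q₁, R.rho (q₁, R.form (q₁, q₂)), proj G q₂, rfl⟩

theorem secondCheckOf_q₁ (R : ReductionData EQ EG EB G Q) (q₀ q₁ q₂ : Q)
    (h : (proj G q₀, proj G q₁) ∈ R.dom.W) : (R.secondCheckOf q₀ q₁ q₂).q₁ = q₁ :=
  R.F₁_form q₀ q₁ h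

theorem secondCheckOf_w₁ (R : ReductionData EQ EG EB G Q) (q₀ q₁ q₂ : Q)
    (h : (proj G q₀, proj G q₁) ∈ R.dom.W) :
    (R.secondCheckOf q₀ q₁ q₂).w₁ = R.form (q₁, q₂) := by
  rw [SecondCheck.w₁, R.secondCheckOf_q₁ q₀ q₁ q₂ h]
  exact R.fibreCoord_rho _ _

/-- `phiBar` evaluates $\check\phi$ at the representative `secondCheckOf`. Only the first term needs
an argument, since it uses the reconstructed $q_1$ and $w_1$; the other three agree by definition.
-/
theorem phiBar_toSecond_secondCheckOf (R : ReductionData EQ EG EB G Q) (q₀ q₁ q₂ : Q)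
    (h : (proj G q₀, proj G q₁) ∈ R.dom.W) (u : TangentSpace 𝓘(ℝ, EB) (proj G q₁)) :
    R.phiBar (R.secondCheckOf q₀ q₁ q₂).toSecond u =
      R.D₁L q₁ (R.form (q₁, q₂)) (proj G q₂) (R.hLift q₁ u) +
      R.D₃L q₀ (R.form (q₀, q₁)) (proj G q₁) u +
      R.forceMinus (R.rho (q₁, R.form (q₁, q₂))) (proj G q₂) u +
      R.forcePlus (R.rho (q₀, R.form (q₀, q₁))) (proj G q₁) u := by
  have e : ∀ (q : Q) (w : G), q = q₁ → w = R.form (q₁, q₂) →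
      (R.D₁L q w (proj G q₂) (R.hLift q u) : ℝ) =
        R.D₁L q₁ (R.form (q₁, q₂)) (proj G q₂) (R.hLift q₁ u) := by
    rintro _ _ rfl rfl
    rfl
  change R.D₁L _ _ (proj G q₂) (R.hLift (R.secondCheckOf q₀ q₁ q₂).q₁ u) + _ + _ + _ = _
  exact congrArg (fun z : ℝ => z + R.D₃L q₀ (R.form (q₀, q₁)) (proj G q₁) u +
      R.forceMinus (R.rho (q₁, R.form (q₁, q₂))) (proj G q₂) u +
      R.forcePlus (R.rho (q₀, R.form (q₀, q₁))) (proj G q₁) u)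
    (e _ _ (R.secondCheckOf_q₁ q₀ q₁ q₂ h) (R.secondCheckOf_w₁ q₀ q₁ q₂ h))

theorem psi_secondCheckOf (R : ReductionData EQ EG EB G Q) (q₀ q₁ q₂ : Q)
    (h : (proj G q₀, proj G q₁) ∈ R.dom.W) (ξ : TangentSpace 𝓘(ℝ, EG) (1 : G)) :
    (R.secondCheckOf q₀ q₁ q₂).psi ξ =
      R.D₂L q₀ (R.form (q₀, q₁)) (proj G q₁) (rightMul ξ (R.form (q₀, q₁))) -
      R.D₂L q₁ (R.form (q₁, q₂)) (proj G q₂) (rightMul ξ (R.form (q₁, q₂))) := by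
  rw [SecondCheck.psi, R.secondCheckOf_q₁ q₀ q₁ q₂ h, R.secondCheckOf_w₁ q₀ q₁ q₂ h]
  rfl

/-- Two points of `Q̌^{(2)}_G` over the same point of `Q^{(2)}_G` differ by the action of `G`. -/
theorem SecondCheck.exists_act_of_toSecond_eq {R : ReductionData EQ EG EB G Q}
    {x y : R.SecondCheck} (h : x.toSecond = y.toSecond) : ∃ g : G, x = y.act g := by
  obtain ⟨q₀, w₀, r₁, v₁, r₂, hx⟩ := x
  obtain ⟨q₀', w₀', r₁', v₁', r₂', hy⟩ := y
  simp only [SecondCheck.toSecond, Second.mk.injEq] at h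
  obtain ⟨h0, rfl, rfl, rfl⟩ := h
  obtain ⟨g, hg⟩ := (TildeG.rho_eq_iff R.bundle).1 h0
  obtain ⟨rfl, rfl⟩ := Prod.mk.inj hg
  exact ⟨g, rfl⟩

/-- The morphism `ψ̄` vanishes on the fibre of `(F₁^* 𝔤^𝒟)/G` over the class of `y` if and only if
`ψ̌` vanishes on the fibre of `F₁^* 𝔤^𝒟` at `y`. -/
theorem psiBar_eq_zero_iff (R : ReductionData EQ EG EB G Q) (y : R.SecondCheck) :
    (∀ z ∈ VertBundle.constrained R, z.base = y.toSecond → R.psiBar z = 0) ↔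
      ∀ ξ ∈ R.gD y.q₁, y.psi ξ = 0 := by
  constructor
  · intro h ξ hξ
    exact h (VertBundle.mk (y, ξ)) ⟨(y, ξ), hξ, rfl⟩ rfl
  · rintro h _ ⟨⟨x, ξ⟩, hξ, rfl⟩ hx
    -- The fixed point `y` is written as a translate of the representative `x`, not conversely.
    -- Equivariance then carries the hypothesis at $\mathrm{Ad}_g\xi$ over `y` straight to $\xi$
    -- over `x`, with no inverses.
    obtain ⟨g, rfl⟩ := SecondCheck.exists_act_of_toSecond_eq (x := y) (y := x) hx.symm
    have h1 := h (adj g ξ) (by rw [SecondCheck.q₁_act]; exact R.adj_mem_gD g _ ξ hξ)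
    rwa [SecondCheck.psi_act] at h1

/-- No differentiation is involved: the induced morphisms are evaluated at the representative
`secondCheckOf`, whose $F_1$-coordinate is $q_1$. -/
theorem reducedEquations_iff (R : ReductionData EQ EG EB G Q) (q₀ q₁ q₂ : Q)
    (h : (proj G q₀, proj G q₁) ∈ R.dom.W) :
    ((∀ u ∈ R.Dhat (proj G q₁),
        R.D₁L q₁ (R.form (q₁, q₂)) (proj G q₂) (R.hLift q₁ u) +
        R.D₃L q₀ (R.form (q₀, q₁)) (proj G q₁) u +
        R.forceMinus (R.rho (q₁, R.form (q₁, q₂))) (proj G q₂) u +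
        R.forcePlus (R.rho (q₀, R.form (q₀, q₁))) (proj G q₁) u = 0) ∧
      ∀ ξ ∈ R.gD q₁,
        R.D₂L q₀ (R.form (q₀, q₁)) (proj G q₁) (rightMul ξ (R.form (q₀, q₁))) -
        R.D₂L q₁ (R.form (q₁, q₂)) (proj G q₂) (rightMul ξ (R.form (q₁, q₂))) = 0) ↔
      (∀ u ∈ R.Dhat (proj G q₁), R.phiBar (R.secondCheckOf q₀ q₁ q₂).toSecond u = 0) ∧
      ∀ z ∈ VertBundle.constrained R,
        z.base = (R.secondCheckOf q₀ q₁ q₂).toSecond → R.psiBar z = 0 := by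
  refine and_congr ?_ ?_
  · refine forall₂_congr fun u _ => ?_
    rw [← R.phiBar_toSecond_secondCheckOf q₀ q₁ q₂ h u]
  · rw [R.psiBar_eq_zero_iff, R.secondCheckOf_q₁ q₀ q₁ q₂ h]
    refine forall₂_congr fun ξ _ => ?_
    rw [R.psi_secondCheckOf q₀ q₁ q₂ h ξ]

/-! #### The variational principles -/

/-- Summation by parts for the differential of the discrete action along variations that vanish
at the end points. -/
theorem dAction_eq (R : ReductionData EQ EG EB G Q) (N : ℕ) (q : ℕ → Q)
    (δq : ∀ k, TangentSpace 𝓘(ℝ, EQ) (q k)) (h0 : δq 0 = 0) (hN : δq N = 0) :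
    R.dAction N q δq = ∑ k ∈ Finset.range (N - 1),
      (R.D₁Ld (q (k + 1)) (q (k + 2)) (δq (k + 1)) +
        R.D₂Ld (q k) (q (k + 1)) (δq (k + 1))) := by
  cases N with
  | zero => rfl
  | succ n =>
    simp only [dAction, dLd_eq, Finset.sum_add_distrib, Nat.add_sub_cancel]
    -- The first summand is removed from the $D_1$ sum, where $\delta q_0=0$, and the last from the
    -- $D_2$ sum, where $\delta q_N=0$. What is left of both sums is indexed by the same interior
    -- vectors $\delta q_{k+1}$.
    rw [Finset.sum_range_succ', Finset.sum_range_succ, h0, hN, map_zero, map_zero, add_zero,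
      add_zero]

/-- The interior values of an admissible variation are independent of one another, so a variation
supported at one index isolates one equation. The equation numbered `k` sits at the middle point
$q_{k+1}$, and `k + 1 < N` therefore covers exactly the interior points. -/
theorem variationalPrinciple_iff (R : ReductionData EQ EG EB G Q) (N : ℕ) (q : ℕ → Q) :
    (∀ δq : ∀ k, TangentSpace 𝓘(ℝ, EQ) (q k), δq 0 = 0 → δq N = 0 →
        (∀ k ≤ N, δq k ∈ R.sys.D (q k)) → R.dAction N q δq = 0) ↔
      ∀ k, k + 1 < N → ∀ u ∈ R.sys.D (q (k + 1)),
        R.D₁Ld (q (k + 1)) (q (k + 2)) u + R.D₂Ld (q k) (q (k + 1)) u = 0 := by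
  constructor
  · intro h k hk u hu
    -- Because `k + 1 < N`, the support of this variation is neither $0$ nor $N$, so the end
    -- conditions hold.
    have h0 : Function.update (0 : ∀ k, TangentSpace 𝓘(ℝ, EQ) (q k)) (k + 1) u 0 = 0 :=
      Function.update_of_ne (by omega) _ _
    have hN : Function.update (0 : ∀ k, TangentSpace 𝓘(ℝ, EQ) (q k)) (k + 1) u N = 0 :=
      Function.update_of_ne (by omega) _ _
    have h1 := h _ h0 hN fun j _ => by
      by_cases hj : j = k + 1
      · subst hj
        simpa using hu
      · rw [Function.update_of_ne hj]
        exact zero_mem _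
    rw [R.dAction_eq N q _ h0 hN, Finset.sum_eq_single_of_mem k
      (Finset.mem_range.2 (by omega))] at h1
    · simpa using h1
    · intro j _ hj
      rw [Function.update_of_ne (by omega)]
      simp
  · intro h δq h0 hN hD
    rw [R.dAction_eq N q _ h0 hN]
    refine Finset.sum_eq_zero fun k hk => ?_
    have hk : k + 1 < N := by have := Finset.mem_range.1 hk; omega
    exact h k hk _ (hD _ hk.le)

/-- By linearity the horizontal and vertical summands of the reduced variation $\delta v$ combine
into the image of the single variation $h(\delta r)+\xi_Q$. -/
theorem dRho_dA_add (R : ReductionData EQ EG EB G Q) (q₀ q₁ : Q)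
    (a a' : TangentSpace 𝓘(ℝ, EQ) q₀) (b b' : TangentSpace 𝓘(ℝ, EQ) q₁) :
    R.dRho q₀ (R.form (q₀, q₁)) a (R.dA q₀ q₁ a b) +
      R.dRho q₀ (R.form (q₀, q₁)) a' (R.dA q₀ q₁ a' b') =
      R.dRho q₀ (R.form (q₀, q₁)) (a + a') (R.dA q₀ q₁ (a + a') (b + b')) := by
  -- Both derivatives are viewed as maps between products of model spaces, where addition of pairs
  -- is componentwise.
  let A : EQ × EQ →L[ℝ] EG := mfderiv (𝓘(ℝ, EQ).prod 𝓘(ℝ, EQ)) 𝓘(ℝ, EG) R.form (q₀, q₁)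
  let ρ' : EQ × EG →L[ℝ] EB × EG := mfderiv (𝓘(ℝ, EQ).prod 𝓘(ℝ, EG)) (𝓘(ℝ, EB).prod 𝓘(ℝ, EG))
    R.rho (q₀, R.form (q₀, q₁))
  have h : ∀ a a' b b' : EQ, ρ' (a, A (a, b)) + ρ' (a', A (a', b')) =
      ρ' (a + a', A (a + a', b + b')) := by
    intro a a' b b'
    rw [← map_add, Prod.mk_add_mk, ← map_add, Prod.mk_add_mk]
  exact h a a' b b'

/-- The differential of the reduced action along the reduced variation given by `(δr, ξ)` is that
of the action along the variation with horizontal part `δr` and vertical part `ξ`. -/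
theorem dActionHat_eq (R : ReductionData EQ EG EB G Q) (N : ℕ) (q : ℕ → Q)
    (hq : ∀ k < N, (proj G (q k), proj G (q (k + 1))) ∈ R.dom.W)
    (δr : ∀ k, TangentSpace 𝓘(ℝ, EB) (proj G (q k))) (ξ : ℕ → TangentSpace 𝓘(ℝ, EG) (1 : G))
    (δv : ∀ k, TangentSpace (𝓘(ℝ, EB).prod 𝓘(ℝ, EG)) (R.rho (q k, R.form (q k, q (k + 1)))))
    (hδv : ∀ k < N, δv k =
      R.dRho (q k) (R.form (q k, q (k + 1))) (R.hLift (q k) (δr k))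
        (R.dA (q k) (q (k + 1)) (R.hLift (q k) (δr k)) (R.hLift (q (k + 1)) (δr (k + 1)))) +
      R.dRho (q k) (R.form (q k, q (k + 1))) (infGen EQ EG G (q k) (ξ k))
        (R.dA (q k) (q (k + 1)) (infGen EQ EG G (q k) (ξ k))
          (infGen EQ EG G (q (k + 1)) (ξ (k + 1))))) :
    R.dActionHat N (fun k => R.rho (q k, R.form (q k, q (k + 1)))) (fun k => proj G (q k)) δv δr =
      R.dAction N q fun k => R.hLift (q k) (δr k) + infGen EQ EG G (q k) (ξ k) := by
  refine Finset.sum_congr rfl fun k hk => ?_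
  have hk := Finset.mem_range.1 hk
  -- Each summand is treated by itself. The base component matches because $d\pi$ of $h(\delta
  -- r_{k+1})+(\xi_{k+1})_Q$ is $\delta r_{k+1}$, the vertical part being annihilated.
  rw [hδv k hk, R.dRho_dA_add, ← R.dLhat_dRho_dA _ _ (hq k hk), map_add (R.dproj (q (k + 1))),
    R.dproj_hLift, R.dproj_infGen, add_zero]

/-- The map $(\delta r,\xi)\mapsto h(\delta r)+\xi_Q$ takes admissible reduced data to admissible
variations with vanishing ends, and reaches all of them by `exists_decomposition`. The two
differentials agree under it by `dActionHat_eq`. -/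
theorem reducedVariationalPrinciple_iff (R : ReductionData EQ EG EB G Q) (N : ℕ) (q : ℕ → Q)
    (hq : ∀ k < N, (proj G (q k), proj G (q (k + 1))) ∈ R.dom.W) :
    (∀ δq : ∀ k, TangentSpace 𝓘(ℝ, EQ) (q k), δq 0 = 0 → δq N = 0 →
        (∀ k ≤ N, δq k ∈ R.sys.D (q k)) → R.dAction N q δq = 0) ↔
      ∀ (δr : ∀ k, TangentSpace 𝓘(ℝ, EB) (proj G (q k)))
        (ξ : ℕ → TangentSpace 𝓘(ℝ, EG) (1 : G))
        (δv : ∀ k, TangentSpace (𝓘(ℝ, EB).prod 𝓘(ℝ, EG)) (R.rho (q k, R.form (q k, q (k + 1))))),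
        δr 0 = 0 → δr N = 0 → ξ 0 = 0 → ξ N = 0 →
        (∀ k ≤ N, δr k ∈ R.Dhat (proj G (q k)) ∧ ξ k ∈ R.gD (q k)) →
        (∀ k < N, δv k =
          R.dRho (q k) (R.form (q k, q (k + 1))) (R.hLift (q k) (δr k))
            (R.dA (q k) (q (k + 1)) (R.hLift (q k) (δr k)) (R.hLift (q (k + 1)) (δr (k + 1)))) +
          R.dRho (q k) (R.form (q k, q (k + 1))) (infGen EQ EG G (q k) (ξ k))
            (R.dA (q k) (q (k + 1)) (infGen EQ EG G (q k) (ξ k))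
              (infGen EQ EG G (q (k + 1)) (ξ (k + 1))))) →
        R.dActionHat N (fun k => R.rho (q k, R.form (q k, q (k + 1)))) (fun k => proj G (q k))
          δv δr = 0 := by
  constructor
  · intro h δr ξ δv hr0 hrN hξ0 hξN hD hδv
    rw [R.dActionHat_eq N q hq δr ξ δv hδv]
    refine h _ (by simp [hr0, hξ0]) (by simp [hrN, hξN]) fun k hk => ?_
    exact add_mem (R.hLift_mem_D _ _ (hD k hk).1) (hD k hk).2
  · intro h δq h0 hN hD
    choose ξ hξ hξD hξ0 using fun k => R.exists_decomposition (q k) (δq k)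
    have h1 := h (fun k => R.dproj (q k) (δq k)) ξ _ (by simp [h0]) (by simp [hN]) (hξ0 0 h0)
      (hξ0 N hN) (fun k hk => ⟨⟨δq k, hD k hk, rfl⟩, hξD k (hD k hk)⟩) fun k _ => rfl
    rw [R.dActionHat_eq N q hq _ ξ _ fun k _ => rfl] at h1
    rwa [funext hξ]

end ReductionData

end DiscreteReduction

end

/-! ### The equivalence of the five conditions -/

theorem mainTheorem2 {EQ EG EB G Q : Type*}
    [NormedAddCommGroup EQ] [NormedSpace ℝ EQ] [FiniteDimensional ℝ EQ]
    [NormedAddCommGroup EG] [NormedSpace ℝ EG] [FiniteDimensional ℝ EG]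
    [NormedAddCommGroup EB] [NormedSpace ℝ EB] [FiniteDimensional ℝ EB]
    [TopologicalSpace G] [ChartedSpace EG G] [Group G] [LieGroup 𝓘(ℝ, EG) ∞ G]
    [TopologicalSpace Q] [ChartedSpace EQ Q] [IsManifold 𝓘(ℝ, EQ) ∞ Q] [MulAction G Q]
    [ChartedSpace EB (Base G Q)] [IsManifold 𝓘(ℝ, EB) ∞ (Base G Q)]
    (R : ReductionData EQ EG EB G Q)
    -- a discrete curve `q_0, …, q_N` with consecutive points in the domain of `𝒜_d`
    (N : ℕ) (q : ℕ → Q) (hq : ∀ k < N, (proj G (q k), proj G (q (k + 1))) ∈ R.dom.W) :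
    let r : ℕ → Base G Q := fun k => proj G (q k)
    let w : ℕ → G := fun k => R.form (q k, q (k + 1))
    let v : ℕ → R.Tilde := fun k => R.rho (q k, w k)
    List.TFAE [
      -- the variational principle
      (∀ k < N, (q k, q (k + 1)) ∈ R.sys.Dd) ∧
        ∀ δq : ∀ k, TangentSpace 𝓘(ℝ, EQ) (q k), δq 0 = 0 → δq N = 0 →
          (∀ k ≤ N, δq k ∈ R.sys.D (q k)) → R.dAction N q δq = 0,
      -- the Lagrange-D'Alembert equations
      (∀ k < N, (q k, q (k + 1)) ∈ R.sys.Dd) ∧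
        ∀ k, k + 1 < N → ∀ u ∈ R.sys.D (q (k + 1)),
          R.D₁Ld (q (k + 1)) (q (k + 2)) u + R.D₂Ld (q k) (q (k + 1)) u = 0,
      -- the reduced variational principle
      (∀ k < N, (v k, r (k + 1)) ∈ R.DdHat) ∧
        ∀ (δr : ∀ k, TangentSpace 𝓘(ℝ, EB) (r k)) (ξ : ℕ → TangentSpace 𝓘(ℝ, EG) (1 : G))
          (δv : ∀ k, TangentSpace (𝓘(ℝ, EB).prod 𝓘(ℝ, EG)) (v k)),
          δr 0 = 0 → δr N = 0 → ξ 0 = 0 → ξ N = 0 →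
          (∀ k ≤ N, δr k ∈ R.Dhat (r k) ∧ ξ k ∈ R.gD (q k)) →
          (∀ k < N, δv k =
            R.dRho (q k) (w k) (R.hLift (q k) (δr k))
              (R.dA (q k) (q (k + 1)) (R.hLift (q k) (δr k)) (R.hLift (q (k + 1)) (δr (k + 1))))
            + R.dRho (q k) (w k) (infGen EQ EG G (q k) (ξ k))
              (R.dA (q k) (q (k + 1)) (infGen EQ EG G (q k) (ξ k))
                (infGen EQ EG G (q (k + 1)) (ξ (k + 1))))) →
          R.dActionHat N v r δv δr = 0,
      -- the reduced equations of motion, in terms of the curve `q`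
      (∀ k < N, (v k, r (k + 1)) ∈ R.DdHat) ∧
        ∀ k, k + 1 < N →
          (∀ u ∈ R.Dhat (r (k + 1)),
            R.D₁L (q (k + 1)) (w (k + 1)) (r (k + 2)) (R.hLift (q (k + 1)) u)
              + R.D₃L (q k) (w k) (r (k + 1)) u
              + R.forceMinus (v (k + 1)) (r (k + 2)) u
              + R.forcePlus (v k) (r (k + 1)) u = 0) ∧
          (∀ ξ ∈ R.gD (q (k + 1)),
            R.D₂L (q k) (w k) (r (k + 1)) (ReductionData.rightMul ξ (w k))
              - R.D₂L (q (k + 1)) (w (k + 1)) (r (k + 2)) (ReductionData.rightMul ξ (w (k + 1))) = 0),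
      -- the intrinsic equations of motion on the second order reduced manifold
      (∀ k < N, (v k, r (k + 1)) ∈ R.DdHat) ∧
        ∀ k, k + 1 < N →
          (∀ u ∈ R.Dhat (r (k + 1)),
            R.phiBar ⟨v k, r (k + 1), v (k + 1), r (k + 2), rfl⟩ u = 0) ∧
          (∀ z ∈ ReductionData.VertBundle.constrained R,
            z.base = ⟨v k, r (k + 1), v (k + 1), r (k + 2), rfl⟩ → R.psiBar z = 0)] := by
  intro r w v
  -- After this rewriting all five conditions share the same kinematic conjunct, and each
  -- equivalence concerns only the dynamical part.
  have hd : (∀ k < N, (v k, r (k + 1)) ∈ R.DdHat) ↔ ∀ k < N, (q k, q (k + 1)) ∈ R.sys.Dd :=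
    forall₂_congr fun k hk => R.mem_DdHat_iff _ _ (hq k hk)
  rw [hd]
  tfae_have 1 ↔ 2 := and_congr Iff.rfl (R.variationalPrinciple_iff N q)
  tfae_have 1 ↔ 3 := and_congr Iff.rfl (R.reducedVariationalPrinciple_iff N q hq)
  tfae_have 2 ↔ 4 := and_congr Iff.rfl <| forall₂_congr fun k hk =>
    R.lagrangeDAlembert_iff _ _ _ (hq k (by omega)) (hq (k + 1) hk)
  -- The point of $Q^{(2)}_G$ in condition 5 is definitionally the image of `secondCheckOf` at three
  -- consecutive points of the curve.
  tfae_have 4 ↔ 5 := and_congr Iff.rfl <| forall₂_congr fun k hk =>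
    R.reducedEquations_iff _ _ _ (hq k (by omega))
  tfae_finish
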